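/- **Setting.** Let $N=M^2$ with an integer $M\ge 2$, let $n,p\ge 1$ be integers, and let $A,\ell,\lambda,z_0>0$; put $\omega=2\pi/\lambda$. Let $r_1,\dots,r_N$, $r_j=(x_j,y_j)$, be an enumeration of the points of the square lattice $\{(a\ell,b\ell): a,b=1,\dots,M\}$. Let $\xi_l,\eta_l$ ($1\le l\le n$) be random variables uniformly distributed on $\{qA/\sqrt N: q=1,\dots,\sqrt N\}$, let $\theta_{kj}$ ($1\le k\le p$, $1\le j\le N$) be random variables uniformly distributed on $[0,2\pi]$, and let all of these be mutually independent. Let $\Phi$ be the random $np\times N$ matrix with entries $$\phi_{ij}=\frac1{\sqrt{np}}\,e^{\mathrm i\omega|x_j-\xi_l|^2/(2z_0)}\,e^{\mathrm i\omega|y_j-\eta_l|^2/(2z_0)}\,e^{\mathrm i\theta_{kj}},\qquad i=(k-1)n+l,$$ with columns $\Phi_1,\dots,\Phi_N$, and let $$\mu(\Phi)=\max_{i\ne j}\frac{|\Phi_j^*\Phi_i|}{\|\Phi_j\|_2\|\Phi_i\|_2}$$ be its worst-case coherence. **Lemma.** Suppose that the Rayleigh condition $\dfrac{A\ell}{\lambda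 z_0}=1$ holds. Then for all $t_1,t_2\ge 0$ such that the two factors on the right-hand side below are not both negative, $$\mathbb P\left[\mu(\Phi)\ge\frac{2t_1t_2}{\sqrt{np}}\right]\ \ge\ \left(1-2t_1\sqrt{\frac2\pi}-\frac4{\sqrt p}\right)\left(1-2t_2\sqrt{\frac2\pi}-\frac4{\sqrt n}\right).$$ -/

import Mathlib

open MeasureTheory ProbabilityTheory

/-- Worst-case coherence of a complex matrix: the maximum over pairs of distinct columns of
`|Φⱼ* Φᵢ| / (‖Φⱼ‖₂ ‖Φᵢ‖₂)`. -/
noncomputable def worstCaseCoherence {ι κ : Type*} [Fintype ι] (Φ : Matrix ι κ ℂ) : ℝ :=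
  ⨆ q : {q : κ × κ // q.1 ≠ q.2},
    ‖∑ i, starRingEnd ℂ (Φ i q.1.2) * Φ i q.1.1‖ /
      (Real.sqrt (∑ i, ‖Φ i q.1.2‖ ^ 2) * Real.sqrt (∑ i, ‖Φ i q.1.1‖ ^ 2))

/-- The set of `M` equispaced values `q A / M`, `q = 1, …, M`, that a sensor coordinate can take
(here `M = √N`). -/
def sensorCoords (M : ℕ) (A : ℝ) : Set ℝ :=
  Set.range fun q : Fin M => ((q : ℕ) + 1 : ℝ) * A / M

/-- The wavenumber `ω = 2π / lam` of a wave of wavelength `lam`. -/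
noncomputable def wavenumber (lam : ℝ) : ℝ := 2 * Real.pi / lam

/-- The `i`-th coordinate of the lattice of spacing `ell`: `ell, 2 ell, …, M ell`. -/
def latticeCoord {M : ℕ} (ell : ℝ) (i : Fin M) : ℝ := ((i : ℕ) + 1 : ℝ) * ell

/-- The sensing matrix with rows indexed by (probe `k`, sensor `l`) and columns indexed by the
points `(x, y)` of the `M × M` square lattice of spacing `ell` (so `N = M ^ 2`): its entries are
`(np)^(-1/2) exp(iω(x - ξₗ)²/(2z₀)) exp(iω(y - ηₗ)²/(2z₀)) exp(iθₖⱼ)`. -/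
noncomputable def sensingMatrix {M n p : ℕ} (lam z₀ ell : ℝ)
    (θ : Fin p → Fin M × Fin M → ℝ) (ξ η : Fin n → ℝ) :
    Matrix (Fin p × Fin n) (Fin M × Fin M) ℂ :=
  Matrix.of fun r j =>
    ((1 / Real.sqrt ((n : ℝ) * p) : ℝ) : ℂ)
      * Complex.exp
          (Complex.I * ((wavenumber lam * (latticeCoord ell j.1 - ξ r.2) ^ 2 / (2 * z₀) : ℝ) : ℂ))
      * Complex.exp
          (Complex.I * ((wavenumber lam * (latticeCoord ell j.2 - η r.2) ^ 2 / (2 * z₀) : ℝ) : ℂ))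
      * Complex.exp (Complex.I * ((θ r.1 j : ℝ) : ℂ))

/-!
For two neighbouring lattice points the inner product of the corresponding columns factors as
`(n p)⁻¹ S T`, where the *probe sum* `S = ∑ₖ exp (i (θₖᵢ - θₖⱼ))` depends only on the `θ`'s, and by the
Rayleigh condition the *sensor sum* `T` has modulus `|∑ₗ exp (2πi ξₗ / A)|` for a horizontal pair and
`|∑ₗ exp (2πi ηₗ / A)|` for a vertical one. All columns have norm one. So the coherence is large as
soon as `|S| ≥ √2 t₁ √p` and `|T| ≥ √2 t₂ √n` for one pair, and the theorem is an anticoncentration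
statement for random walks with unit steps in the plane.

Berry–Esseen bounds are avoided by using more than one pair of columns. The four corners of a lattice
square give two disjoint horizontal pairs, with the same `T` and independent copies of `S`; the two
vertical pairs have a sensor sum that is independent of the horizontal one. Conditioning on the
sensors (`mul_le_measureReal_inter_union_inter`), it suffices that two independent copies of a walk
are both short with probability at most `2 t √(2/π) + 4 / √n`, that is, to bound the *square* of
the probability that a single walk is short (`measureReal_norm_sum_lt_sq_le`).

The steps are centred and have a centred square (`M`-th roots of unity with `M ≥ 3`, or uniform on the
circle), so their characteristic function is at most `exp (-‖g‖² / 4)` on the unit disc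
(`norm_charFun_map_le_exp`). Integrating it against a Gaussian density bounds
`E exp (-b ‖S‖²)` by its value for a Gaussian vector plus an exponentially small term, and Markov's
inequality with an optimized `b` finishes. For `M = 2` the steps are signs, and the largest binomial
coefficient gives the bound for a single walk (`measureReal_abs_sum_lt_le`).
-/

/-! ### Characteristic functions of isotropic unit steps -/

theorem cos_le_one_sub_sq_div_two_add (y : ℝ) (hy : |y| ≤ 1) :
    Real.cos y ≤ 1 - y ^ 2 / 2 + y ^ 4 / 24 := by
  have h := Real.sin_ge_sub_cube (x := |y| / 2) (by positivity)
  have hc : Real.cos y = 1 - 2 * Real.sin (|y| / 2) ^ 2 := by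
    rw [← Real.cos_abs, ← Real.cos_two_mul_eq_one_sub]; ring_nf
  have h0 : 0 ≤ |y| / 2 - (|y| / 2) ^ 3 / 6 := by
    have := pow_le_pow_of_le_one (abs_nonneg y) hy (show 1 ≤ 3 by norm_num)
    linarith [abs_nonneg y]
  have h2 := pow_le_pow_left₀ h0 h 2
  have h3 : y ^ 2 = |y| ^ 2 := (sq_abs y).symm
  have h4 : y ^ 4 = |y| ^ 4 := (Even.pow_abs (by decide) y).symm
  rw [hc, h3, h4]
  have : 0 ≤ |y| ^ 6 := by positivity
  nlinarith

theorem one_sub_add_sub_le_exp_neg (x : ℝ) (h0 : 0 ≤ x) (h1 : x ≤ 1) :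
    1 - x + x ^ 2 / 2 - x ^ 3 / 6 ≤ Real.exp (-x) := by
  have h := Real.exp_bound (x := -x) (by rwa [abs_neg, abs_of_nonneg h0]) (n := 5) (by norm_num)
  rw [abs_neg, abs_of_nonneg h0, abs_le] at h
  have h2 := h.1
  simp [Finset.sum_range_succ, Nat.factorial] at h2
  have : x ^ 5 ≤ x ^ 4 := pow_le_pow_of_le_one h0 h1 (by norm_num)
  have : 0 ≤ x ^ 4 := by positivity
  nlinarith

/-- A centred random variable on the unit circle whose square is also centred has the covariance of
an isotropic vector; near the origin its characteristic function is dominated by the one of the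
Gaussian vector with the same covariance. -/
theorem norm_charFun_map_le_exp {Ω : Type*} [MeasurableSpace Ω] {P : Measure Ω}
    [IsProbabilityMeasure P] {X : Ω → ℂ} (hX : Measurable X) (hX1 : ∀ x, ‖X x‖ = 1)
    (hmean : ∫ x, X x ∂P = 0) (hsq : ∫ x, X x ^ 2 ∂P = 0) {g : ℂ} (hg : ‖g‖ ≤ 1) :
    ‖charFun (P.map X) g‖ ≤ Real.exp (-(‖g‖ ^ 2 / 4)) := by
  set Y : Ω → ℝ := fun x => inner ℝ (X x) g with hY
  have hYm : Measurable Y := by fun_prop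
  have hYle : ∀ x, |Y x| ≤ ‖g‖ := fun x => by
    have h := abs_real_inner_le_norm (X x) g
    rwa [hX1 x, one_mul] at h
  have hYI : ∀ (f : ℝ → ℝ) (_ : Continuous f), Integrable (fun x => f (Y x)) P := by
    intro f hf
    obtain ⟨C, hC⟩ := (isCompact_Icc (a := -‖g‖) (b := ‖g‖)).exists_bound_of_continuousOn
      hf.continuousOn
    exact Integrable.of_bound (hf.measurable.comp hYm).aestronglyMeasurable C
      (ae_of_all _ fun x => hC _ (abs_le.1 (hYle x)))
  have hXI : Integrable X P := Integrable.of_bound hX.aestronglyMeasurable 1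
    (ae_of_all _ fun x => (hX1 x).le)
  have hX2I : Integrable (fun x => X x ^ 2) P :=
    Integrable.of_bound (hX.pow_const 2).aestronglyMeasurable 1
      (ae_of_all _ fun x => by simp [hX1 x])
  have hY1 : ∫ x, Y x ∂P = 0 := by
    have : ∀ x, Y x = (starRingEnd ℂ g * X x).re := fun x => by
      simp [hY, Complex.inner]
    simp_rw [this]
    have h := integral_re (𝕜 := ℂ) (hXI.const_mul (starRingEnd ℂ g))
    simp only [RCLike.re_to_complex] at h
    rw [h, integral_const_mul, hmean]; simp
  have hY2 : ∫ x, Y x ^ 2 ∂P = ‖g‖ ^ 2 / 2 := by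
    have : ∀ x, Y x ^ 2 = ‖g‖ ^ 2 / 2 + (starRingEnd ℂ g ^ 2 / 2 * X x ^ 2).re := fun x => by
      have h1 : (X x).re * (X x).re + (X x).im * (X x).im = 1 := by
        rw [← Complex.normSq_apply, Complex.normSq_eq_norm_sq, hX1 x]; norm_num
      rw [← Complex.normSq_eq_norm_sq, Complex.normSq_apply]
      simp [hY, Complex.inner, pow_two]
      linear_combination ((g.re * g.re + g.im * g.im) / 2) * h1
    simp_rw [this]
    have h := integral_re (𝕜 := ℂ) (hX2I.const_mul (starRingEnd ℂ g ^ 2 / 2))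
    have h' := (hX2I.const_mul (starRingEnd ℂ g ^ 2 / 2)).re
    simp only [RCLike.re_to_complex] at h h'
    rw [integral_add (integrable_const _) h', h, integral_const_mul, hsq]; simp
  set r := ‖g‖ ^ 2 with hr
  have hr0 : 0 ≤ r := by positivity
  have hr1 : r ≤ 1 := by rw [hr]; exact pow_le_one₀ (norm_nonneg _) hg
  have hcos_le : ∫ x, Real.cos (Y x) ∂P ≤ 1 - r / 4 + r ^ 2 / 48 := by
    have hpt : ∀ x, Real.cos (Y x) ≤ 1 - (1 / 2 - r / 24) * Y x ^ 2 := fun x => by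
      have h1 := cos_le_one_sub_sq_div_two_add (Y x) ((hYle x).trans hg)
      have h2 : Y x ^ 2 ≤ r := by rw [hr, ← sq_abs]; gcongr; exact hYle x
      nlinarith [mul_le_mul_of_nonneg_left h2 (sq_nonneg (Y x))]
    have hi : Integrable (fun x => (1 / 2 - r / 24) * Y x ^ 2) P :=
      hYI (fun y => (1 / 2 - r / 24) * y ^ 2) (by fun_prop)
    calc _ ≤ ∫ x, (1 - (1 / 2 - r / 24) * Y x ^ 2) ∂P :=
          integral_mono (hYI _ Real.continuous_cos) ((integrable_const 1).sub hi) hpt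
      _ = _ := by
          rw [integral_sub (integrable_const _) hi, integral_const_mul, hY2]; simp; ring
  have hcos_ge : 0 ≤ ∫ x, Real.cos (Y x) ∂P := by
    refine integral_nonneg fun x => ?_
    have h2 : Y x ^ 2 ≤ r := by rw [hr, ← sq_abs]; gcongr; exact hYle x
    have := Real.one_sub_sq_div_two_le_cos (x := Y x)
    simp only [Pi.zero_apply]; linarith
  have hsin : |∫ x, Real.sin (Y x) ∂P| ≤ ‖g‖ * r / 12 := by
    have hpt : ∀ x, |Y x - Real.sin (Y x)| ≤ ‖g‖ / 6 * Y x ^ 2 := fun x => by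
      refine (Real.abs_sub_sin_le _).trans ?_
      have : |Y x| ^ 3 = |Y x| * Y x ^ 2 := by rw [← sq_abs]; ring
      rw [this]
      nlinarith [mul_le_mul_of_nonneg_right (hYle x) (sq_nonneg (Y x))]
    have hi : ∫ x, Real.sin (Y x) ∂P = -∫ x, (Y x - Real.sin (Y x)) ∂P := by
      rw [integral_sub (hYI (fun y => y) continuous_id) (hYI _ Real.continuous_sin), hY1]; ring
    rw [hi, abs_neg]
    refine (abs_integral_le_integral_abs).trans ?_
    calc _ ≤ ∫ x, ‖g‖ / 6 * Y x ^ 2 ∂P :=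
          integral_mono (hYI (fun y => |y - Real.sin y|) (by fun_prop))
            (hYI (fun y => ‖g‖ / 6 * y ^ 2) (by fun_prop)) hpt
      _ = _ := by rw [integral_const_mul, hY2]; ring
  have hφ : ‖charFun (P.map X) g‖ ^ 2 =
      (∫ x, Real.cos (Y x) ∂P) ^ 2 + (∫ x, Real.sin (Y x) ∂P) ^ 2 := by
    rw [charFun_apply, integral_map hX.aemeasurable (by fun_prop)]
    have he : Integrable (fun x => Complex.exp ((Y x : ℂ) * Complex.I)) P :=
      Integrable.of_bound (by fun_prop) 1
        (ae_of_all _ fun x => (Complex.norm_exp_ofReal_mul_I _).le)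
    have h1 := integral_re (𝕜 := ℂ) he
    have h2 := integral_im (𝕜 := ℂ) he
    simp only [RCLike.re_to_complex, RCLike.im_to_complex, Complex.exp_ofReal_mul_I_re,
      Complex.exp_ofReal_mul_I_im] at h1 h2
    rw [h1, h2, ← Complex.normSq_eq_norm_sq, Complex.normSq_apply]
    ring
  have hsin2 : (∫ x, Real.sin (Y x) ∂P) ^ 2 ≤ r ^ 3 / 144 := by
    rw [← sq_abs]
    calc _ ≤ (‖g‖ * r / 12) ^ 2 := by gcongr
      _ = _ := by rw [hr]; ring
  have hcos2 : (∫ x, Real.cos (Y x) ∂P) ^ 2 ≤ (1 - r / 4 + r ^ 2 / 48) ^ 2 := by gcongr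
  have hexp := one_sub_add_sub_le_exp_neg (r / 2) (by positivity) (by linarith)
  refine abs_le_of_sq_le_sq' ?_ (Real.exp_pos _).le |>.2
  rw [hφ, ← Real.exp_nat_mul]
  have he : ((2 : ℕ) : ℝ) * -(r / 4) = -(r / 2) := by push_cast; ring
  rw [he]
  -- The gap is `r² / 48 * (1 - r + …)`, nonnegative up to `r = 1` but not much beyond.
  have hfin : (1 - r / 4 + r ^ 2 / 48) ^ 2 + r ^ 3 / 144 ≤
      1 - r / 2 + (r / 2) ^ 2 / 2 - (r / 2) ^ 3 / 6 := by
    have : r ^ 3 ≤ r ^ 2 := pow_le_pow_of_le_one hr0 hr1 (by norm_num)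
    have : r ^ 4 ≤ r ^ 2 := pow_le_pow_of_le_one hr0 hr1 (by norm_num)
    nlinarith [sq_nonneg r]
  linarith

/-! ### Gaussian smoothing -/

theorem integral_norm_gt_one_exp_neg_mul_sq {β : ℝ} (hβ : 0 < β) :
    ∫ g : ℂ, {g : ℂ | 1 < ‖g‖}.indicator (fun g => Real.exp (-β * ‖g‖ ^ 2)) g =
      Real.pi / β * Real.exp (-β) := by
  have hpolar := integral_fun_norm_addHaar (volume : Measure ℂ)
    ((Set.Ioi (1 : ℝ)).indicator fun y => Real.exp (-β * y ^ 2))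
  have hind : ∀ g : ℂ, (Set.Ioi (1 : ℝ)).indicator (fun y => Real.exp (-β * y ^ 2)) ‖g‖ =
      {g : ℂ | 1 < ‖g‖}.indicator (fun g => Real.exp (-β * ‖g‖ ^ 2)) g := fun g => by
    simp [Set.indicator]
  simp_rw [hind] at hpolar
  rw [hpolar]
  have hvol : (volume : Measure ℂ).real (Metric.ball 0 1) = Real.pi := by
    simp [Measure.real, Complex.volume_ball]
  have hderiv : ∀ y ∈ Set.Ici (1 : ℝ), HasDerivAt (fun y => -Real.exp (-β * y ^ 2) / (2 * β))
      (y * Real.exp (-β * y ^ 2)) y := fun y _ => by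
    have h := ((((hasDerivAt_id y).pow 2).const_mul (-β)).exp.neg).div_const (2 * β)
    convert! h using 1
    simp; field_simp
  have hlim : Filter.Tendsto (fun y : ℝ => -Real.exp (-β * y ^ 2) / (2 * β)) Filter.atTop
      (nhds 0) := by
    have h1 : Filter.Tendsto (fun y : ℝ => -β * y ^ 2) Filter.atTop Filter.atBot :=
      (Filter.tendsto_pow_atTop two_ne_zero).const_mul_atTop_of_neg (neg_lt_zero.2 hβ)
    simpa using ((Real.tendsto_exp_atBot.comp h1).neg).div_const (2 * β)
  have hint := integral_Ioi_of_hasDerivAt_of_nonneg' (a := (1 : ℝ)) hderiv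
    (fun y hy => by have : (1 : ℝ) < y := hy; positivity) hlim
  have hrad : ∫ y in Set.Ioi (0 : ℝ), y ^ (Module.finrank ℝ ℂ - 1) •
      (Set.Ioi (1 : ℝ)).indicator (fun y => Real.exp (-β * y ^ 2)) y =
      Real.exp (-β) / (2 * β) := by
    have : ∀ y : ℝ, y ^ (Module.finrank ℝ ℂ - 1) •
        (Set.Ioi (1 : ℝ)).indicator (fun y => Real.exp (-β * y ^ 2)) y =
        (Set.Ioi (1 : ℝ)).indicator (fun y => y * Real.exp (-β * y ^ 2)) y := fun y => by
      simp [Set.indicator, Complex.finrank_real_complex]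
    simp_rw [this]
    rw [setIntegral_indicator measurableSet_Ioi,
      Set.inter_eq_self_of_subset_right (Set.Ioi_subset_Ioi zero_le_one), hint]
    simp; ring
  rw [hrad, hvol, Complex.finrank_real_complex]
  simp; field_simp

/-- Gaussian smoothing in the plane. `exp (-‖s‖² / (4β))` is the Fourier transform of a Gaussian
density in the frequency `g`, so a Gaussian bound for the characteristic function on the unit disc
bounds its mean; the second term is the Gaussian mass of the frequencies outside that disc. -/
theorem integral_exp_neg_norm_sq_le {μ : Measure ℂ} [IsProbabilityMeasure μ] {a β : ℝ}
    (ha : 0 ≤ a) (hβ : 0 < β)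
    (hμ : ∀ g : ℂ, ‖g‖ ≤ 1 → ‖charFun μ g‖ ≤ Real.exp (-(a * ‖g‖ ^ 2))) :
    ∫ s, Real.exp (-‖s‖ ^ 2 / (4 * β)) ∂μ ≤ β / (β + a) + Real.exp (-β) := by
  have hGint : ∀ b : ℝ, 0 < b → Integrable (fun g : ℂ => Real.exp (-b * ‖g‖ ^ 2)) := fun b hb => by
    have h := (GaussianFourier.integrable_cexp_neg_mul_sq_norm_add (V := ℂ) (b := (b : ℂ))
      (by simpa using hb) 0 0).norm
    refine h.congr (ae_of_all _ fun g => ?_)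
    simp [Complex.norm_exp, ← Complex.ofReal_pow]
  have hGval : ∀ b : ℝ, 0 < b → ∫ g : ℂ, Real.exp (-b * ‖g‖ ^ 2) = Real.pi / b := fun b hb => by
    rw [GaussianFourier.integral_rexp_neg_mul_sq_norm hb]
    simp [Complex.finrank_real_complex]
  let F : ℂ → ℂ → ℂ := fun s g => Complex.exp (-(β : ℂ) * ‖g‖ ^ 2 + Complex.I * (inner ℝ s g : ℝ))
  have hFdef : F = fun s g => Complex.exp (-(β : ℂ) * ‖g‖ ^ 2 + Complex.I * (inner ℝ s g : ℝ)) := rfl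
  have hF : ∀ s : ℂ, ∫ g : ℂ, F s g =
      ((Real.pi / β * Real.exp (-‖s‖ ^ 2 / (4 * β)) : ℝ) : ℂ) := fun s => by
    have h := GaussianFourier.integral_cexp_neg_mul_sq_norm_add (V := ℂ) (b := (β : ℂ))
      (by simpa using hβ) Complex.I s
    rw [hFdef, h]
    simp [Complex.finrank_real_complex]
  have hFnorm : ∀ s g, ‖F s g‖ = Real.exp (-β * ‖g‖ ^ 2) := fun s g => by
    simp [hFdef, Complex.norm_exp, ← Complex.ofReal_pow]
  have hprod : Integrable (Function.uncurry F) (μ.prod volume) := by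
    have h := (integrable_const (1 : ℝ) (μ := μ)).mul_prod (hGint β hβ)
    refine h.mono' (by fun_prop) (ae_of_all _ fun q => ?_)
    simp [Function.uncurry, hFnorm]
  have hswap : ∫ s, (∫ g, F s g) ∂μ = ∫ g, ∫ s, F s g ∂μ := integral_integral_swap hprod
  have hinner : ∀ g, ∫ s, F s g ∂μ = Real.exp (-β * ‖g‖ ^ 2) * charFun μ g := fun g => by
    rw [charFun_apply, ← integral_const_mul]
    congr 1 with s
    simp [hFdef, Complex.exp_add, mul_comm Complex.I]
  simp only [hinner, hF] at hswap
  rw [integral_complex_ofReal, integral_const_mul] at hswap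
  have hbound : Real.pi / β * ∫ s, Real.exp (-‖s‖ ^ 2 / (4 * β)) ∂μ ≤
      Real.pi / (β + a) + Real.pi / β * Real.exp (-β) := by
    have hnn : 0 ≤ Real.pi / β * ∫ s, Real.exp (-‖s‖ ^ 2 / (4 * β)) ∂μ :=
      mul_nonneg (by positivity) (integral_nonneg fun s => (Real.exp_pos _).le)
    have hnorm := congrArg norm hswap
    rw [Complex.norm_real, Real.norm_eq_abs, abs_of_nonneg hnn] at hnorm
    rw [hnorm, ← hGval (β + a) (by positivity), ← integral_norm_gt_one_exp_neg_mul_sq hβ]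
    have hI2 : Integrable ({g : ℂ | 1 < ‖g‖}.indicator (fun g => Real.exp (-β * ‖g‖ ^ 2))) :=
      (hGint β hβ).indicator (measurableSet_lt measurable_const measurable_norm)
    rw [← integral_add (hGint _ (by positivity)) hI2]
    refine norm_integral_le_of_norm_le ((hGint _ (by positivity)).add hI2) (ae_of_all _ fun g => ?_)
    rw [norm_mul, Complex.norm_real, Real.norm_eq_abs, Real.abs_exp]
    by_cases hg : ‖g‖ ≤ 1
    · have : Real.exp (-(β + a) * ‖g‖ ^ 2) =
          Real.exp (-β * ‖g‖ ^ 2) * Real.exp (-(a * ‖g‖ ^ 2)) := by rw [← Real.exp_add]; ring_nf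
      rw [Set.indicator_of_notMem (by simpa using hg), add_zero, this]
      gcongr
      exact hμ g hg
    · rw [Set.indicator_of_mem (by simpa using hg)]
      have := norm_charFun_le_one (μ := μ) g
      nlinarith [Real.exp_pos (-β * ‖g‖ ^ 2), Real.exp_pos (-(β + a) * ‖g‖ ^ 2)]
  have hpos : 0 < Real.pi / β := by positivity
  refine le_of_mul_le_mul_left (hbound.trans_eq ?_) hpos
  field_simp

/-- Markov's inequality for the Gaussian weight of `integral_exp_neg_norm_sq_le`, with
`β = n / (4 w)`. -/
theorem measureReal_norm_lt_le {μ : Measure ℂ} [IsProbabilityMeasure μ] {n w s : ℝ}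
    (hn : 0 < n) (hw : 0 < w)
    (hμ : ∀ g : ℂ, ‖g‖ ≤ 1 → ‖charFun μ g‖ ≤ Real.exp (-(n / 4 * ‖g‖ ^ 2))) :
    μ.real {z | ‖z‖ < s * Real.sqrt n} ≤
      Real.exp (w * s ^ 2) * (1 / (1 + w) + Real.exp (-(n / (4 * w)))) := by
  have h := integral_exp_neg_norm_sq_le (by positivity) (β := n / (4 * w)) (by positivity) hμ
  have he : ∀ z : ℂ, -‖z‖ ^ 2 / (4 * (n / (4 * w))) = -(w / n * ‖z‖ ^ 2) := fun z => by field_simp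
  simp_rw [he] at h
  have hI : Integrable (fun z : ℂ => Real.exp (-(w / n * ‖z‖ ^ 2))) μ := by
    refine Integrable.of_bound (by fun_prop) 1 (ae_of_all _ fun z => ?_)
    rw [Real.norm_eq_abs, Real.abs_exp, Real.exp_le_one_iff]
    have : 0 ≤ w / n * ‖z‖ ^ 2 := by positivity
    linarith
  have hM := mul_meas_ge_le_integral_of_nonneg (ae_of_all _ fun z => (Real.exp_pos _).le) hI
    (Real.exp (-(w * s ^ 2)))
  have hsub : {z : ℂ | ‖z‖ < s * Real.sqrt n} ⊆
      {z | Real.exp (-(w * s ^ 2)) ≤ Real.exp (-(w / n * ‖z‖ ^ 2))} := fun z hz => by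
    have hz' : ‖z‖ ≤ s * Real.sqrt n := le_of_lt hz
    have h2 : ‖z‖ ^ 2 ≤ s ^ 2 * n := by
      calc _ ≤ (s * Real.sqrt n) ^ 2 := by gcongr
        _ = _ := by rw [mul_pow, Real.sq_sqrt hn.le]
    rw [Set.mem_ofPred_eq, Real.exp_le_exp, neg_le_neg_iff]
    calc _ ≤ w / n * (s ^ 2 * n) := by gcongr
      _ = _ := by field_simp
  have h3 : n / (4 * w) / (n / (4 * w) + n / 4) = 1 / (1 + w) := by field_simp
  rw [h3] at h
  calc _ ≤ μ.real {z | Real.exp (-(w * s ^ 2)) ≤ Real.exp (-(w / n * ‖z‖ ^ 2))} :=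
        measureReal_mono hsub
    _ = Real.exp (w * s ^ 2) * (Real.exp (-(w * s ^ 2)) *
        μ.real {z | Real.exp (-(w * s ^ 2)) ≤ Real.exp (-(w / n * ‖z‖ ^ 2))}) := by
        rw [← mul_assoc, ← Real.exp_add]; simp
    _ ≤ _ := by gcongr; exact hM.trans h

/-! ### Anticoncentration of planar walks -/

theorem pow_three_mul_exp_le (s : ℝ) :
    s ^ 3 * Real.exp (2 * (1 - s ^ 2)) ≤ 1.071 := by
  -- `u * exp (1 - u) ≤ 1` at `u = 4 s² / 3`, cubed, is the square of the claim.
  have hu : 4 * s ^ 2 / 3 * Real.exp (1 - 4 * s ^ 2 / 3) ≤ 1 := by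
    have h1 := Real.add_one_le_exp (4 * s ^ 2 / 3 - 1)
    have h2 : Real.exp (4 * s ^ 2 / 3 - 1) * Real.exp (1 - 4 * s ^ 2 / 3) = 1 := by
      rw [← Real.exp_add]; simp
    nlinarith [Real.exp_pos (1 - 4 * s ^ 2 / 3)]
  have h3 : (4 * s ^ 2 / 3 * Real.exp (1 - 4 * s ^ 2 / 3)) ^ 3 ≤ 1 :=
    pow_le_one₀ (by positivity) hu
  have h4 : (s ^ 3 * Real.exp (2 * (1 - s ^ 2))) ^ 2 =
      27 / 64 * Real.exp 1 * (4 * s ^ 2 / 3 * Real.exp (1 - 4 * s ^ 2 / 3)) ^ 3 := by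
    have : Real.exp (2 * (1 - s ^ 2)) ^ 2 =
        Real.exp 1 * Real.exp (1 - 4 * s ^ 2 / 3) ^ 3 := by
      rw [← Real.exp_nat_mul, ← Real.exp_nat_mul, ← Real.exp_add]
      congr 1; push_cast; ring
    rw [mul_pow, this]; ring
  refine abs_le_of_sq_le_sq' ?_ (by norm_num) |>.2
  rw [h4]
  nlinarith [Real.exp_one_lt_d9, Real.exp_pos 1]

theorem le_two_div_sqrt_pi : 1.128 ≤ 2 / Real.sqrt Real.pi := by
  have h : Real.sqrt Real.pi ≤ 1.773 :=
    Real.sqrt_le_iff.2 ⟨by norm_num, by linarith [Real.pi_lt_d4]⟩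
  rw [le_div_iff₀ (by positivity)]
  linarith

/-- Optimization of the free parameter of `measureReal_norm_lt_le`. Up to the exponentially small
term the best choice is `w = 1 / s² - 1`; for small `s` that term is no longer negligible, and
`w = 1 / s - 1` is used instead. -/
theorem sq_le_of_forall_le_exp_mul {q s n : ℝ} (hq : 0 ≤ q) (hs0 : 0 < s) (hs1 : s < 1)
    (hn : 4 * Real.pi ≤ n * s ^ 2)
    (h : ∀ w : ℝ, 0 < w →
      q ≤ Real.exp (w * s ^ 2) * (1 / (1 + w) + Real.exp (-(n / (4 * w))))) :
    q ^ 2 ≤ 2 / Real.sqrt Real.pi * s := by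
  -- The decimal bounds in both cases leave a margin of at least one per cent below `1.128`.
  refine le_trans ?_ (mul_le_mul_of_nonneg_right le_two_div_sqrt_pi hs0.le)
  have hπ := Real.pi_gt_d2
  rcases le_or_gt s 0.62 with hs | hs
  · have hw : 0 < 1 / s - 1 := by rw [sub_pos, lt_div_iff₀ hs0]; linarith
    have hq' := h _ hw
    have e1 : (1 / s - 1) * s ^ 2 = s * (1 - s) := by field_simp
    have e2 : 1 / (1 + (1 / s - 1)) = s := by field_simp; ring
    rw [e1, e2] at hq'
    have hss : 0 < s * (1 - s) := mul_pos hs0 (by linarith)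
    have e3 : Real.pi / (s * (1 - s)) ≤ n / (4 * (1 / s - 1)) := by
      have : n / (4 * (1 / s - 1)) = n * s ^ 2 / (4 * (s * (1 - s))) := by
        rw [← e1]; field_simp
      rw [this, div_le_div_iff₀ hss (by positivity)]
      nlinarith
    have htail : Real.exp (-(n / (4 * (1 / s - 1)))) ≤ 0.033 * s := by
      set y := Real.pi / (s * (1 - s)) with hy
      have hy0 : 0 < y := by positivity
      have h1 : Real.exp (-(n / (4 * (1 / s - 1)))) ≤ Real.exp (-y) :=
        Real.exp_le_exp.2 (by linarith)
      have h2 : Real.exp (-y) ≤ 2 / y ^ 2 := by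
        rw [Real.exp_neg, inv_eq_one_div, div_le_div_iff₀ (Real.exp_pos y) (by positivity)]
        linarith [Real.quadratic_le_exp_of_nonneg hy0.le]
      have h3 : 2 / y ^ 2 = 2 / Real.pi ^ 2 * (s * (1 - s) ^ 2) * s := by
        rw [hy]; field_simp
      have h4 : s * (1 - s) ^ 2 ≤ 4 / 27 := by
        nlinarith [mul_nonneg (sq_nonneg (3 * s - 1)) (show 0 ≤ 4 - 3 * s by linarith)]
      have h5 : 2 / Real.pi ^ 2 ≤ 0.21 := by
        rw [div_le_iff₀ (by positivity)]; nlinarith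
      have h6 : 2 / Real.pi ^ 2 * (s * (1 - s) ^ 2) ≤ 0.21 * (4 / 27) := by gcongr
      rw [h3] at h2
      nlinarith
    have hexp : Real.exp (s * (1 - s)) ^ 2 ≤ 1.6488 := by
      have h1 : Real.exp (s * (1 - s)) ^ 4 ≤ Real.exp 1 := by
        rw [← Real.exp_nat_mul]
        exact Real.exp_le_exp.2 (by push_cast; nlinarith [sq_nonneg (2 * s - 1)])
      refine abs_le_of_sq_le_sq' ?_ (by norm_num) |>.2
      rw [← pow_mul]
      exact h1.trans (by linarith [Real.exp_one_lt_d9])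
    have hq2 : q ≤ Real.exp (s * (1 - s)) * (1.033 * s) :=
      hq'.trans (by gcongr; linarith)
    calc q ^ 2 ≤ (Real.exp (s * (1 - s)) * (1.033 * s)) ^ 2 := by gcongr
      _ = Real.exp (s * (1 - s)) ^ 2 * (1.033 * s) ^ 2 := by ring
      _ ≤ 1.6488 * (1.033 * s) ^ 2 := by gcongr
      _ ≤ 1.128 * s := by nlinarith
  · have hs2 : 0.3844 ≤ s ^ 2 := by nlinarith
    have hss : 0 < 1 - s ^ 2 := by nlinarith
    have hw : 0 < 1 / s ^ 2 - 1 := by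
      rw [sub_pos, lt_div_iff₀ (by positivity)]; linarith
    have hq' := h _ hw
    have e1 : (1 / s ^ 2 - 1) * s ^ 2 = 1 - s ^ 2 := by field_simp
    have e2 : 1 / (1 + (1 / s ^ 2 - 1)) = s ^ 2 := by field_simp; ring
    rw [e1, e2] at hq'
    have e3 : 5 ≤ n / (4 * (1 / s ^ 2 - 1)) := by
      have : n / (4 * (1 / s ^ 2 - 1)) = n * s ^ 2 / (4 * (1 - s ^ 2)) := by
        rw [← e1]; field_simp
      rw [this, le_div_iff₀ (by positivity)]
      nlinarith
    have htail : Real.exp (-(n / (4 * (1 / s ^ 2 - 1)))) ≤ 0.00674 := by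
      have h1 : Real.exp (-(n / (4 * (1 / s ^ 2 - 1)))) ≤ Real.exp (-5) :=
        Real.exp_le_exp.2 (by linarith)
      have h2 : 148.39 ≤ Real.exp 5 := by
        have : Real.exp 5 = Real.exp 1 ^ 5 := by rw [← Real.exp_nat_mul]; norm_num
        rw [this]
        calc (148.39 : ℝ) ≤ 2.7182 ^ 5 := by norm_num
          _ ≤ _ := by gcongr; linarith [Real.exp_one_gt_d9]
      refine h1.trans ?_
      rw [Real.exp_neg, inv_eq_one_div, div_le_iff₀ (Real.exp_pos 5)]
      linarith
    have hq2 : q ≤ Real.exp (1 - s ^ 2) * (1.0176 * s ^ 2) :=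
      hq'.trans (by gcongr; linarith)
    calc q ^ 2 ≤ (Real.exp (1 - s ^ 2) * (1.0176 * s ^ 2)) ^ 2 := by gcongr
      _ = 1.0176 ^ 2 * (s ^ 3 * Real.exp (2 * (1 - s ^ 2))) * s := by
        have : Real.exp (2 * (1 - s ^ 2)) = Real.exp (1 - s ^ 2) ^ 2 := by
          rw [← Real.exp_nat_mul]; norm_num
        rw [this]; ring
      _ ≤ 1.0176 ^ 2 * 1.071 * s := by gcongr; exact pow_three_mul_exp_le s
      _ ≤ 1.128 * s := by gcongr; norm_num

/-- Anticoncentration for a random walk in the plane with unit steps and isotropic covariance. The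
square is the probability that two independent copies are both short; without it the right-hand side
would be out of reach of exponential moments. -/
theorem measureReal_norm_sum_lt_sq_le {Ω : Type*} [MeasurableSpace Ω] {P : Measure Ω}
    [IsProbabilityMeasure P] {n : ℕ} (hn : 1 ≤ n) {X : Fin n → Ω → ℂ}
    (hX : ∀ k, Measurable (X k)) (hX1 : ∀ k x, ‖X k x‖ = 1)
    (hmean : ∀ k, ∫ x, X k x ∂P = 0) (hsq : ∀ k, ∫ x, X k x ^ 2 ∂P = 0)
    (hindep : iIndepFun X P) {t : ℝ} (ht : 0 ≤ t) :
    P.real {x | ‖∑ k, X k x‖ < Real.sqrt 2 * t * Real.sqrt n} ^ 2 ≤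
      2 * t * Real.sqrt (2 / Real.pi) + 4 / Real.sqrt n := by
  set r := 2 * t * Real.sqrt (2 / Real.pi) + 4 / Real.sqrt n with hr
  rcases le_or_gt 1 r with hr1 | hr1
  · exact (pow_le_one₀ measureReal_nonneg measureReal_le_one).trans hr1
  have hn0 : (0 : ℝ) < n := by exact_mod_cast hn
  have hsn : 0 < Real.sqrt n := Real.sqrt_pos.2 hn0
  have hsπ : 0 < Real.sqrt Real.pi := Real.sqrt_pos.2 Real.pi_pos
  have hπ2 : Real.sqrt Real.pi ≤ 2 :=
    Real.sqrt_le_iff.2 ⟨by norm_num, by linarith [Real.pi_le_four]⟩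
  have hs : Real.sqrt Real.pi / 2 * r = Real.sqrt 2 * t + 2 * Real.sqrt Real.pi / Real.sqrt n := by
    rw [hr, Real.sqrt_div zero_le_two]; field_simp; ring
  -- Enlarging the radius to `s √n` with `s = r √π / 2` absorbs the term `4 / √n`; in return
  -- `n s² ≥ 4π`.
  set s := Real.sqrt Real.pi / 2 * r with hsdef
  have hs0 : 0 < s := by rw [hs]; positivity
  have hs1 : s < 1 := by nlinarith [(show 0 < r by positivity)]
  have hns : 4 * Real.pi ≤ n * s ^ 2 := by
    have h1 : 2 * Real.sqrt Real.pi / Real.sqrt n ≤ s := by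
      rw [hs]; exact le_add_of_nonneg_left (by positivity)
    rw [div_le_iff₀ hsn] at h1
    calc 4 * Real.pi = (2 * Real.sqrt Real.pi) ^ 2 := by
          rw [mul_pow, Real.sq_sqrt Real.pi_pos.le]; norm_num
      _ ≤ (s * Real.sqrt n) ^ 2 := by gcongr
      _ = _ := by rw [mul_pow, Real.sq_sqrt hn0.le]; ring
  set S : Ω → ℂ := fun x => ∑ k, X k x with hS
  have hSm : Measurable S := by fun_prop
  have := Measure.isProbabilityMeasure_map (μ := P) hSm.aemeasurable
  have hchar : ∀ g : ℂ, ‖g‖ ≤ 1 → ‖charFun (P.map S) g‖ ≤ Real.exp (-(n / 4 * ‖g‖ ^ 2)) := by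
    intro g hg
    rw [hS, hindep.charFun_map_fun_sum_eq_prod fun k => (hX k).aemeasurable, Finset.prod_apply,
      norm_prod]
    calc _ ≤ ∏ _k : Fin n, Real.exp (-(‖g‖ ^ 2 / 4)) :=
          Finset.prod_le_prod (fun _ _ => norm_nonneg _)
            fun k _ => norm_charFun_map_le_exp (hX k) (hX1 k) (hmean k) (hsq k) hg
      _ = _ := by
        rw [Finset.prod_const, Finset.card_univ, Fintype.card_fin, ← Real.exp_nat_mul]; ring_nf
  have hr2 : 2 / Real.sqrt Real.pi * s = r := by rw [hsdef]; field_simp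
  rw [← hr2]
  have hmono : P.real {x | ‖∑ k, X k x‖ < Real.sqrt 2 * t * Real.sqrt n} ≤
      (P.map S).real {z | ‖z‖ < s * Real.sqrt n} := by
    rw [map_measureReal_apply hSm (measurableSet_lt measurable_norm measurable_const)]
    refine measureReal_mono fun x (hx : ‖S x‖ < _) => show ‖S x‖ < _ from hx.trans_le ?_
    rw [hs]
    gcongr
    exact le_add_of_nonneg_right (by positivity)
  calc _ ≤ (P.map S).real {z | ‖z‖ < s * Real.sqrt n} ^ 2 := by gcongr
    _ ≤ _ := sq_le_of_forall_le_exp_mul measureReal_nonneg hs0 hs1 hns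
      fun w hw => measureReal_norm_lt_le hn0 hw hchar

/-! ### Anticoncentration of sign sums -/

theorem centralBinom_sq_mul_le (m : ℕ) : m.centralBinom ^ 2 * (2 * m + 1) ≤ 4 ^ (2 * m) := by
  induction m with
  | zero => simp
  | succ m ih =>
    have h := Nat.succ_mul_centralBinom_succ m
    have h1 : ((m + 1) * (m + 1).centralBinom) ^ 2 = (2 * (2 * m + 1) * m.centralBinom) ^ 2 := by
      rw [h]
    have hpos : 0 < (m + 1) ^ 2 := by positivity
    refine Nat.le_of_mul_le_mul_left ?_ hpos
    calc (m + 1) ^ 2 * ((m + 1).centralBinom ^ 2 * (2 * (m + 1) + 1))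
        = ((m + 1) * (m + 1).centralBinom) ^ 2 * (2 * m + 3) := by ring
      _ = 4 * ((2 * m + 1) * (2 * m + 3)) * (m.centralBinom ^ 2 * (2 * m + 1)) := by rw [h1]; ring
      _ ≤ 4 * (4 * (m + 1) ^ 2) * 4 ^ (2 * m) :=
        Nat.mul_le_mul (by nlinarith) ih
      _ = (m + 1) ^ 2 * 4 ^ (2 * (m + 1)) := by ring

theorem choose_half_sq_mul_le (n : ℕ) : (n.choose (n / 2)) ^ 2 * (n + 1) ≤ 4 ^ n := by
  obtain ⟨m, rfl | rfl⟩ := n.even_or_odd'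
  · have h := centralBinom_sq_mul_le m
    rwa [Nat.mul_div_cancel_left _ two_pos, ← Nat.centralBinom_eq_two_mul_choose]
  · have h := centralBinom_sq_mul_le (m + 1)
    have h2 : (m + 1).centralBinom = 2 * (2 * m + 1).choose m := by
      rw [Nat.centralBinom_eq_two_mul_choose, show 2 * (m + 1) = (2 * m + 1) + 1 by ring,
        Nat.choose_succ_succ, Nat.choose_symm_half]
      ring
    have h3 : (2 * m + 1) / 2 = m := by omega
    rw [h3]
    rw [h2] at h
    have h4 : 4 ^ (2 * (m + 1)) = 4 * 4 ^ (2 * m + 1) := by ring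
    nlinarith [sq_nonneg ((2 * m + 1).choose m)]

theorem card_filter_abs_two_mul_sub_lt (n : ℕ) {R : ℝ} (hR : 0 ≤ R) :
    (((Finset.range (n + 1)).filter fun k : ℕ => |2 * (k : ℝ) - n| < R).card : ℝ) ≤ R + 1 := by
  set K := (Finset.range (n + 1)).filter fun k : ℕ => |2 * (k : ℝ) - n| < R with hK
  rcases K.eq_empty_or_nonempty with h | h
  · rw [h]; simp; linarith
  · have hmin := (Finset.mem_filter.1 (K.min'_mem h)).2
    have hmax := (Finset.mem_filter.1 (K.max'_mem h)).2
    have hle : K.min' h ≤ K.max' h := K.min'_le _ (K.max'_mem h)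
    have hsub : K ⊆ Finset.Icc (K.min' h) (K.max' h) := fun k hk =>
      Finset.mem_Icc.2 ⟨K.min'_le _ hk, K.le_max' _ hk⟩
    have hc := Finset.card_le_card hsub
    rw [Nat.card_Icc] at hc
    have hc' : (K.card : ℝ) ≤ K.max' h + 1 - K.min' h := by
      have : K.card + K.min' h ≤ K.max' h + 1 := by omega
      have : ((K.card + K.min' h : ℕ) : ℝ) ≤ ((K.max' h + 1 : ℕ) : ℝ) := by exact_mod_cast this
      push_cast at this; linarith
    rw [abs_lt] at hmin hmax
    linarith [hmin.1, hmax.2]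

/-- Anticoncentration for the simple random walk on the line, from the largest binomial
coefficient. -/
theorem measureReal_abs_sum_lt_le {Ω : Type*} [MeasurableSpace Ω] {P : Measure Ω}
    [IsProbabilityMeasure P] {n : ℕ} {ε : Fin n → Ω → ℝ}
    (hε : ∀ l, Measurable (ε l)) (hindep : iIndepFun ε P)
    (hpos : ∀ l, P.real (ε l ⁻¹' {1}) = 1 / 2) (hneg : ∀ l, P.real (ε l ⁻¹' {-1}) = 1 / 2)
    {R : ℝ} (hR : 0 ≤ R) :
    P.real {x | |∑ l, ε l x| < R} ≤ (R + 1) / Real.sqrt (n + 1) := by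
  classical
  set E : Finset (Fin n) → Set Ω := fun s => ⋂ l, ε l ⁻¹' {if l ∈ s then 1 else -1} with hE
  have hPE : ∀ s, P.real (E s) = (1 / 2) ^ n := fun s => by
    have h := hindep.measure_inter_preimage_eq_mul Finset.univ
      (sets := fun l => {if l ∈ s then 1 else -1}) fun l _ => measurableSet_singleton _
    have h2 : P.real (E s) = ∏ l, P.real (ε l ⁻¹' {if l ∈ s then 1 else -1}) := by
      simp only [Finset.mem_univ, Set.iInter_true] at h
      rw [Measure.real, hE, h, ENNReal.toReal_prod]; rfl
    rw [h2, Finset.prod_congr rfl (g := fun _ => 1 / 2)]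
    · simp
    · intro l _
      split_ifs
      exacts [hpos l, hneg l]
  have hae : ∀ᵐ x ∂P, ∀ l, ε l x = 1 ∨ ε l x = -1 := by
    refine ae_all_iff.2 fun l => ?_
    have hd : Disjoint (ε l ⁻¹' {1}) (ε l ⁻¹' {-1}) :=
      Disjoint.preimage _ (by simp; norm_num)
    have hu : P.real (ε l ⁻¹' {1} ∪ ε l ⁻¹' {-1}) = 1 := by
      rw [measureReal_union hd (hε l (measurableSet_singleton _)), hpos, hneg]; norm_num
    have hu' : P (ε l ⁻¹' {1} ∪ ε l ⁻¹' {-1}) = 1 := by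
      rw [Measure.real, ENNReal.toReal_eq_one_iff] at hu; exact hu
    exact (prob_compl_eq_zero_iff (((hε l (measurableSet_singleton _)).union
      (hε l (measurableSet_singleton _))))).2 hu'
  set F : Finset (Finset (Fin n)) := Finset.univ.filter fun s => |2 * (s.card : ℝ) - n| < R with hF
  have hsum : ∀ s x, x ∈ E s → ∑ l, ε l x = 2 * (s.card : ℝ) - n := fun s x hx => by
    have : ∀ l, ε l x = 2 * (if l ∈ s then 1 else 0) - 1 := fun l => by
      have : ε l x = if l ∈ s then 1 else -1 := Set.mem_iInter.1 hx l
      rw [this]; split_ifs <;> norm_num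
    simp_rw [this]
    rw [Finset.sum_sub_distrib, ← Finset.mul_sum]
    simp
  -- Almost surely the signs are those of some `E s`, so only the sets in `F` matter.
  have hcover : P.real {x | |∑ l, ε l x| < R} ≤ P.real (⋃ s ∈ F, E s) := by
    refine ENNReal.toReal_mono (measure_ne_top _ _) (measure_mono_ae ?_)
    filter_upwards [hae] with x hx (hxR : |∑ l, ε l x| < R)
    have hxE : x ∈ E (Finset.univ.filter fun l => ε l x = 1) := by
      refine Set.mem_iInter.2 fun l => ?_
      simp only [Finset.mem_filter, Finset.mem_univ, true_and, Set.mem_preimage,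
        Set.mem_singleton_iff]
      rcases hx l with h | h
      · simp [h]
      · rw [h, if_neg (by norm_num)]
    refine Set.mem_iUnion₂.2 ⟨_, ?_, hxE⟩
    rw [hF, Finset.mem_filter, ← hsum _ x hxE]
    exact ⟨Finset.mem_univ _, hxR⟩
  have hcard : (F.card : ℝ) ≤ (R + 1) * n.choose (n / 2) := by
    set K := (Finset.range (n + 1)).filter fun k : ℕ => |2 * (k : ℝ) - n| < R with hK
    have hmaps : ∀ s ∈ F, s.card ∈ K := fun s hs => by
      rw [hK, Finset.mem_filter, Finset.mem_range, Nat.lt_succ_iff]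
      exact ⟨by simpa using Finset.card_le_univ s, (Finset.mem_filter.1 hs).2⟩
    have h1 : F.card ≤ K.card * n.choose (n / 2) := by
      rw [mul_comm]
      refine Finset.card_le_mul_card_image_of_maps_to hmaps _ fun k _ => ?_
      refine le_trans (Finset.card_le_card (t := Finset.powersetCard k Finset.univ) ?_) ?_
      · intro s hs
        simpa [Finset.mem_powersetCard] using (Finset.mem_filter.1 hs).2
      · rw [Finset.card_powersetCard, Finset.card_univ, Fintype.card_fin]
        exact Nat.choose_le_middle k n
    calc (F.card : ℝ) ≤ K.card * n.choose (n / 2) := by exact_mod_cast h1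
      _ ≤ _ := by gcongr; exact card_filter_abs_two_mul_sub_lt n hR
  have hchoose : (n.choose (n / 2) : ℝ) * (1 / 2) ^ n ≤ 1 / Real.sqrt (n + 1) := by
    have h := choose_half_sq_mul_le n
    have h' : ((n.choose (n / 2) : ℝ)) ^ 2 * (n + 1) ≤ 4 ^ n := by exact_mod_cast h
    rw [le_div_iff₀ (by positivity)]
    refine abs_le_of_sq_le_sq' ?_ zero_le_one |>.2
    rw [mul_pow, mul_pow, Real.sq_sqrt (by positivity), ← pow_mul, mul_comm n 2, pow_mul]
    calc _ = ((n.choose (n / 2) : ℝ)) ^ 2 * (n + 1) * ((1 / 2) ^ 2) ^ n := by ring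
      _ ≤ 4 ^ n * ((1 / 2) ^ 2) ^ n := by gcongr
      _ = 1 ^ 2 := by rw [← mul_pow]; norm_num
  calc _ ≤ P.real (⋃ s ∈ F, E s) := hcover
    _ ≤ ∑ s ∈ F, P.real (E s) := measureReal_biUnion_finset_le _ _
    _ = F.card * (1 / 2) ^ n := by simp [hPE]
    _ ≤ (R + 1) * n.choose (n / 2) * (1 / 2) ^ n := by gcongr
    _ = (R + 1) * (n.choose (n / 2) * (1 / 2) ^ n) := by ring
    _ ≤ (R + 1) * (1 / Real.sqrt (n + 1)) := by gcongr
    _ = _ := by ring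

/-! ### Moments of the probe and sensor phases -/

theorem integral_comp_of_map_eq_uniformOn_sensorCoords {Ω : Type*} [MeasurableSpace Ω]
    {P : Measure Ω} {M : ℕ} (hM : M ≠ 0) {A : ℝ} (hA : A ≠ 0) {ξ : Ω → ℝ} (hξ : Measurable ξ)
    (hlaw : P.map ξ = uniformOn (sensorCoords M A)) {E : Type*} [NormedAddCommGroup E]
    [NormedSpace ℝ E] [CompleteSpace E] {f : ℝ → E} (hf : StronglyMeasurable f) :
    ∫ x, f (ξ x) ∂P = (M : ℝ)⁻¹ • ∑ q ∈ Finset.range M, f ((q + 1 : ℝ) * A / M) := by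
  classical
  have hM' : (M : ℝ) ≠ 0 := by exact_mod_cast hM
  set c : ℕ → ℝ := fun q => (q + 1 : ℝ) * A / M with hc
  have hcinj : Function.Injective c := fun a b hab => by
    simp only [hc] at hab
    field_simp at hab
    exact_mod_cast (by linarith : (a : ℝ) = b)
  have hset : sensorCoords M A = ((Finset.range M).image c : Finset ℝ) := by
    ext y
    simp only [sensorCoords, Set.mem_range, Finset.coe_image, Finset.coe_range, Set.mem_image,
      Set.mem_Iio, hc]
    exact ⟨fun ⟨q, hq⟩ => ⟨q, q.2, hq⟩, fun ⟨q, hq, h⟩ => ⟨⟨q, hq⟩, h⟩⟩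
  have hint : IntegrableOn f ((Finset.range M).image c : Finset ℝ) Measure.count := by
    rw [← Set.biUnion_of_singleton (((Finset.range M).image c : Finset ℝ) : Set ℝ)]
    exact (integrableOn_finite_biUnion (Finset.finite_toSet _)).2
      fun _ _ => integrableOn_singleton (hx := by simp)
  rw [← integral_map hξ.aemeasurable hf.aestronglyMeasurable, hlaw, hset, uniformOn,
    ProbabilityTheory.cond, integral_smul_measure, Measure.count_apply_finset,
    setIntegral_finset _ hint, Finset.sum_image hcinj.injOn,
    Finset.card_image_of_injective _ hcinj]
  simp [Measure.real, hc]

theorem integral_cexp_eq_zero_of_isUniform {Ω : Type*} [MeasurableSpace Ω] {P : Measure Ω}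
    {θ : Ω → ℝ} (hθ : Measurable θ)
    (hlaw : pdf.IsUniform θ (Set.Icc 0 (2 * Real.pi)) P volume) {m : ℤ} (hm : m ≠ 0) :
    ∫ x, Complex.exp (m * Complex.I * θ x) ∂P = 0 := by
  have h := integral_map (μ := P) hθ.aemeasurable
    (f := fun y : ℝ => Complex.exp (m * Complex.I * y)) (by fun_prop)
  rw [← h, hlaw, ProbabilityTheory.cond, integral_smul_measure, integral_Icc_eq_integral_Ioc,
    ← intervalIntegral.integral_of_le (by positivity),
    integral_exp_mul_complex (by simp [hm])]
  have : Complex.exp (m * Complex.I * ((2 * Real.pi : ℝ) : ℂ)) = 1 := by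
    rw [Complex.exp_eq_one_iff]; exact ⟨m, by push_cast; ring⟩
  rw [this]; simp

theorem integral_cexp_sub_eq_zero {Ω : Type*} [MeasurableSpace Ω] {P : Measure Ω}
    {θ θ' : Ω → ℝ} (hθ : Measurable θ) (hθ' : Measurable θ')
    (hlaw : pdf.IsUniform θ (Set.Icc 0 (2 * Real.pi)) P volume) (hindep : IndepFun θ θ' P)
    {m : ℤ} (hm : m ≠ 0) :
    ∫ x, Complex.exp (Complex.I * ((θ x - θ' x : ℝ) : ℂ)) ^ m ∂P = 0 := by
  have h := hindep.integral_fun_comp_mul_comp (𝕜 := ℂ) hθ.aemeasurable hθ'.aemeasurable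
    (f := fun y : ℝ => Complex.exp (m * Complex.I * y))
    (g := fun y : ℝ => Complex.exp (-m * Complex.I * y)) (by fun_prop) (by fun_prop)
  rw [integral_cexp_eq_zero_of_isUniform hθ hlaw hm, zero_mul] at h
  rw [← h]
  congr 1 with x
  rw [← Complex.exp_add, ← Complex.exp_int_mul]
  congr 1; push_cast; ring

theorem integral_cexp_sensor_eq_zero {Ω : Type*} [MeasurableSpace Ω] {P : Measure Ω} {M : ℕ}
    {A : ℝ} (hA : A ≠ 0) {ξ : Ω → ℝ} (hξ : Measurable ξ)
    (hlaw : P.map ξ = uniformOn (sensorCoords M A)) {m : ℕ} (hm : 0 < m) (hmM : m < M) :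
    ∫ x, Complex.exp (Complex.I * ((2 * Real.pi / A * ξ x : ℝ) : ℂ)) ^ m ∂P = 0 := by
  have hM : M ≠ 0 := by omega
  rw [integral_comp_of_map_eq_uniformOn_sensorCoords hM hA hξ hlaw
    (f := fun y => Complex.exp (Complex.I * ((2 * Real.pi / A * y : ℝ) : ℂ)) ^ m)
    (by fun_prop : Continuous _).stronglyMeasurable]
  have hζ := Complex.isPrimitiveRoot_exp M hM
  set ζ := Complex.exp (2 * Real.pi * Complex.I / M) with hζdef
  have hterm : ∀ q : ℕ, Complex.exp (Complex.I *
      ((2 * Real.pi / A * ((q + 1 : ℝ) * A / M) : ℝ) : ℂ)) ^ m = ζ ^ m * (ζ ^ m) ^ q := fun q => by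
    have hA' : (A : ℂ) ≠ 0 := by exact_mod_cast hA
    rw [← pow_succ', ← pow_mul, mul_comm m, pow_mul, hζdef, ← Complex.exp_nat_mul _ (q + 1)]
    congr 2
    push_cast
    field_simp
  simp_rw [hterm]
  rw [← Finset.mul_sum]
  have hne : ζ ^ m ≠ 1 := hζ.pow_ne_one_of_pos_of_lt hm.ne' hmM
  have hgeom : ∑ q ∈ Finset.range M, (ζ ^ m) ^ q = 0 := by
    rw [geom_sum_eq hne, ← pow_mul, mul_comm, pow_mul, hζ.pow_eq_one]; simp
  simp [hgeom]

/-- Two sensor positions per axis: the cosine of the phase is a fair sign. -/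
theorem measureReal_cos_sensor_two {Ω : Type*} [MeasurableSpace Ω] {P : Measure Ω}
    {A : ℝ} (hA : A ≠ 0) {ξ : Ω → ℝ} (hξ : Measurable ξ)
    (hlaw : P.map ξ = uniformOn (sensorCoords 2 A)) {y : ℝ} (hy : y = 1 ∨ y = -1) :
    P.real ((fun x => Real.cos (2 * Real.pi / A * ξ x)) ⁻¹' {y}) = 1 / 2 := by
  have hcos : Measurable fun z : ℝ => Real.cos (2 * Real.pi / A * z) := by fun_prop
  have hB : MeasurableSet ((fun z : ℝ => Real.cos (2 * Real.pi / A * z)) ⁻¹' {y}) :=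
    hcos (measurableSet_singleton y)
  have h := integral_comp_of_map_eq_uniformOn_sensorCoords two_ne_zero hA hξ hlaw
    (f := ((fun z : ℝ => Real.cos (2 * Real.pi / A * z)) ⁻¹' {y}).indicator fun _ => (1 : ℝ))
    (stronglyMeasurable_const.indicator hB)
  have h2 : P.real ((fun x => Real.cos (2 * Real.pi / A * ξ x)) ⁻¹' {y}) =
      ∫ x, ((fun z : ℝ => Real.cos (2 * Real.pi / A * z)) ⁻¹' {y}).indicator
        (fun _ => (1 : ℝ)) (ξ x) ∂P := by
    exact (integral_indicator_one ((hcos.comp hξ) (measurableSet_singleton y))).symm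
  have c1 : Real.cos (2 * Real.pi / A * (A / 2)) = -1 := by
    rw [show 2 * Real.pi / A * (A / 2) = Real.pi by field_simp, Real.cos_pi]
  have c2 : Real.cos (2 * Real.pi / A * A) = 1 := by
    rw [show 2 * Real.pi / A * A = 2 * Real.pi by field_simp, Real.cos_two_pi]
  have e1 : ((0 : ℕ) + 1 : ℝ) * A / (2 : ℕ) = A / 2 := by norm_num
  have e2 : ((1 : ℕ) + 1 : ℝ) * A / (2 : ℕ) = A := by norm_num
  rw [h2, h, Finset.sum_range_succ, Finset.sum_range_one, e1, e2]
  rcases hy with rfl | rfl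
  · rw [Set.indicator_of_notMem (by rw [Set.mem_preimage, c1]; norm_num),
      Set.indicator_of_mem (by rw [Set.mem_preimage, c2]; rfl)]
    norm_num
  · rw [Set.indicator_of_mem (by rw [Set.mem_preimage, c1]; rfl),
      Set.indicator_of_notMem (by rw [Set.mem_preimage, c2]; norm_num)]
    norm_num

/-! ### Independence of blocks -/

/-- Disjoint blocks of an independent family are independent. -/
theorem iIndepFun_curry {Ω ι : Type*} [MeasurableSpace Ω] {P : Measure Ω} {κ : ι → Type*}
    {E : Type*} [MeasurableSpace E] {X : (i : ι) → κ i → Ω → E}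
    (hX : ∀ i j, Measurable (X i j)) (h : iIndepFun (fun (q : (i : ι) × κ i) => X q.1 q.2) P) :
    iIndepFun (fun i x => (X i · x)) P := by
  have := h.isProbabilityMeasure
  have hp : ∀ i j, IsProbabilityMeasure (P.map (X i j)) :=
    fun i j => Measure.isProbabilityMeasure_map (hX i j).aemeasurable
  have hp' : ∀ i, IsProbabilityMeasure (P.map fun x => (X i · x)) :=
    fun i => Measure.isProbabilityMeasure_map (Measurable.aemeasurable (by fun_prop))
  have hrow : ∀ i, P.map (fun x => (X i · x)) = Measure.infinitePi fun j => P.map (X i j) :=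
    fun i => (iIndepFun_iff_map_fun_eq_infinitePi_map (hX i)).1
      (h.precomp (g := Sigma.mk i) sigma_mk_injective)
  have hall := (iIndepFun_iff_map_fun_eq_infinitePi_map (by fun_prop)).1 h
  rw [iIndepFun_iff_map_fun_eq_infinitePi_map (by fun_prop)]
  simp_rw [hrow]
  rw [← Measure.infinitePi_map_piCurry (fun i j => P.map (X i j)), ← hall,
    Measure.map_map (by fun_prop) (by fun_prop)]
  rfl

theorem indepFun_pi_of_forall_ne {Ω ι α β : Type*} [Fintype α] [Fintype β] [MeasurableSpace Ω]
    {P : Measure Ω} {E : Type*} [MeasurableSpace E] {f : ι → Ω → E} (hf : ∀ i, Measurable (f i))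
    (h : iIndepFun f P) {a : α → ι} {b : β → ι} (hab : ∀ i j, a i ≠ b j) :
    IndepFun (fun x i => f (a i) x) (fun x j => f (b j) x) P := by
  classical
  have hd : Disjoint (Finset.univ.image a) (Finset.univ.image b) := by
    rw [Finset.disjoint_left]
    rintro _ hi hj
    obtain ⟨i, -, rfl⟩ := Finset.mem_image.1 hi
    obtain ⟨j, -, hj⟩ := Finset.mem_image.1 hj
    exact hab i j hj.symm
  exact (h.indepFun_finset _ _ hd hf).comp
    (φ := fun v i => v ⟨a i, Finset.mem_image_of_mem a (Finset.mem_univ i)⟩)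
    (ψ := fun v j => v ⟨b j, Finset.mem_image_of_mem b (Finset.mem_univ j)⟩)
    (by fun_prop) (by fun_prop)

/-- `U`, `U'` are the events that the probe sums of the horizontal and the vertical pairs are long,
`V`, `V'` the same for the sensor sums. Although `U` and `U'` are dependent, splitting on which of
`V`, `V'` occurs keeps the product form. -/
theorem mul_le_measureReal_inter_union_inter {Ω : Type*} [MeasurableSpace Ω] {P : Measure Ω}
    [IsProbabilityMeasure P] {U U' V V' : Set Ω} (hU' : MeasurableSet U') (hV : MeasurableSet V)
    (hV' : MeasurableSet V') (h : P.real (U ∩ V) = P.real U * P.real V)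
    (h' : P.real (U' ∩ (V' \ V)) = P.real U' * P.real (V' \ V)) {u v : ℝ} (hu0 : 0 ≤ u)
    (hu : u ≤ P.real U) (hu' : u ≤ P.real U') (hv : v ≤ P.real (V ∪ V')) :
    u * v ≤ P.real (U ∩ V ∪ U' ∩ V') := by
  have hd : Disjoint (U ∩ V) (U' ∩ (V' \ V)) :=
    Set.disjoint_left.2 fun x hx hx' => hx'.2.2 hx.2
  have hVV : P.real (V ∪ V') = P.real V + P.real (V' \ V) := by
    rw [← Set.union_sdiff_self, measureReal_union Set.disjoint_sdiff_right (hV'.diff hV)]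
  calc u * v ≤ u * P.real (V ∪ V') := by gcongr
    _ = u * P.real V + u * P.real (V' \ V) := by rw [hVV]; ring
    _ ≤ P.real U * P.real V + P.real U' * P.real (V' \ V) := by gcongr
    _ = P.real (U ∩ V ∪ U' ∩ (V' \ V)) := by
      rw [measureReal_union hd (hU'.inter (hV'.diff hV)), h, h']
    _ ≤ _ := measureReal_mono (by gcongr; exact Set.sdiff_subset)

/-! ### Factorization of the inner products -/

theorem le_worstCaseCoherence_sensingMatrix {M n p : ℕ} (hn : 1 ≤ n) (hp : 1 ≤ p)
    (lam z₀ ell : ℝ) (θ : Fin p → Fin M × Fin M → ℝ) (ξ η : Fin n → ℝ) {i j : Fin M × Fin M}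
    (hij : i ≠ j) :
    ‖∑ k, Complex.exp (Complex.I * ((θ k i - θ k j : ℝ) : ℂ))‖ *
      ‖∑ l, Complex.exp (Complex.I *
        ((wavenumber lam / (2 * z₀) *
          ((latticeCoord ell i.1 - ξ l) ^ 2 - (latticeCoord ell j.1 - ξ l) ^ 2 +
            ((latticeCoord ell i.2 - η l) ^ 2 - (latticeCoord ell j.2 - η l) ^ 2)) : ℝ) : ℂ))‖ /
        (n * p) ≤
      worstCaseCoherence (sensingMatrix lam z₀ ell θ ξ η) := by
  have hnp : (0 : ℝ) < n * p := by
    have : (0 : ℝ) < n := by exact_mod_cast hn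
    have : (0 : ℝ) < p := by exact_mod_cast hp
    positivity
  have hcol : ∀ q, Real.sqrt (∑ r, ‖sensingMatrix lam z₀ ell θ ξ η r q‖ ^ 2) = 1 := fun q => by
    have : ∀ r, ‖sensingMatrix lam z₀ ell θ ξ η r q‖ ^ 2 = 1 / (n * p) := fun r => by
      simp only [sensingMatrix, Matrix.of_apply, norm_mul, Complex.norm_real,
        Complex.norm_exp_I_mul_ofReal, mul_one]
      rw [Real.norm_eq_abs, sq_abs, div_pow, Real.sq_sqrt hnp.le, one_pow]
    simp_rw [this]
    rw [Finset.sum_const, Finset.card_univ, Fintype.card_prod, Fintype.card_fin, Fintype.card_fin]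
    simp only [nsmul_eq_mul, Nat.cast_mul]
    rw [show (p : ℝ) * n * (1 / (n * p)) = 1 by field_simp, Real.sqrt_one]
  have hle := le_ciSup (f := fun q : {q : (Fin M × Fin M) × (Fin M × Fin M) // q.1 ≠ q.2} =>
    ‖∑ r, starRingEnd ℂ (sensingMatrix lam z₀ ell θ ξ η r q.1.2) *
        sensingMatrix lam z₀ ell θ ξ η r q.1.1‖ /
      (Real.sqrt (∑ r, ‖sensingMatrix lam z₀ ell θ ξ η r q.1.2‖ ^ 2) *
        Real.sqrt (∑ r, ‖sensingMatrix lam z₀ ell θ ξ η r q.1.1‖ ^ 2)))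
    (Set.finite_range _).bddAbove ⟨(i, j), hij⟩
  refine le_trans (le_of_eq ?_) hle
  simp only [hcol, mul_one, div_one]
  have hentry : ∀ r : Fin p × Fin n, starRingEnd ℂ (sensingMatrix lam z₀ ell θ ξ η r j) *
      sensingMatrix lam z₀ ell θ ξ η r i =
      ((1 / (n * p) : ℝ) : ℂ) * (Complex.exp (Complex.I * ((θ r.1 i - θ r.1 j : ℝ) : ℂ)) *
        Complex.exp (Complex.I * ((wavenumber lam / (2 * z₀) *
          ((latticeCoord ell i.1 - ξ r.2) ^ 2 - (latticeCoord ell j.1 - ξ r.2) ^ 2 +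
            ((latticeCoord ell i.2 - η r.2) ^ 2 -
              (latticeCoord ell j.2 - η r.2) ^ 2)) : ℝ) : ℂ))) := fun r => by
    have hsq : ((1 / (n * p) : ℝ) : ℂ) = ((1 / Real.sqrt ((n : ℝ) * p) : ℝ) : ℂ) *
        ((1 / Real.sqrt ((n : ℝ) * p) : ℝ) : ℂ) := by
      rw [← Complex.ofReal_mul, div_mul_div_comm, Real.mul_self_sqrt hnp.le, one_mul]
    have hconj : ∀ y : ℝ, starRingEnd ℂ (Complex.exp (Complex.I * y)) =
        Complex.exp (-(Complex.I * y)) := fun y => by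
      rw [← Complex.exp_conj, map_mul, Complex.conj_I, Complex.conj_ofReal, neg_mul]
    simp only [sensingMatrix, Matrix.of_apply, map_mul, Complex.conj_ofReal, hconj]
    rw [hsq, ← Complex.exp_add]
    have hexp : ∀ c a b d a' b' d' : ℂ,
        c * Complex.exp (-a) * Complex.exp (-b) * Complex.exp (-d) *
          (c * Complex.exp a' * Complex.exp b' * Complex.exp d') =
        c * c * Complex.exp (a' + b' + d' + -a + -b + -d) := fun c a b d a' b' d' => by
      simp only [Complex.exp_add]; ring
    rw [hexp]
    congr 2
    push_cast
    ring
  simp_rw [hentry]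
  rw [← Finset.mul_sum, Fintype.sum_prod_type]
  simp only []
  rw [← Finset.sum_mul_sum, norm_mul, norm_mul,
    Complex.norm_real, Real.norm_eq_abs, abs_of_pos (by positivity)]
  ring

/-! ### Probe and sensor sums -/

/-- The sum of the unit complex numbers with arguments `φ l`. -/
noncomputable def phaseSum {n : ℕ} (φ : Fin n → ℝ) : ℂ :=
  ∑ l, Complex.exp (Complex.I * (φ l : ℂ))

theorem continuous_phaseSum {n : ℕ} : Continuous (phaseSum (n := n)) := by
  unfold phaseSum; fun_prop

theorem norm_phaseSum_const_add {n : ℕ} (c : ℝ) (φ : Fin n → ℝ) :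
    ‖phaseSum fun l => c + φ l‖ = ‖phaseSum φ‖ := by
  have : phaseSum (fun l => c + φ l) = Complex.exp (Complex.I * c) * phaseSum φ := by
    simp only [phaseSum, Finset.mul_sum, ← Complex.exp_add]
    congr 1 with l
    congr 1; push_cast; ring
  rw [this, norm_mul, Complex.norm_exp_I_mul_ofReal, one_mul]

theorem measureReal_inter_preimage_eq_mul_of_indepFun {Ω β γ : Type*}
    [MeasurableSpace Ω] [MeasurableSpace β] [MeasurableSpace γ] {P : Measure Ω} {X : Ω → β}
    {Y : Ω → γ} (h : IndepFun X Y P) {s : Set β} {t : Set γ} (hs : MeasurableSet s) (ht : MeasurableSet t) :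
    P.real (X ⁻¹' s ∩ Y ⁻¹' t) = P.real (X ⁻¹' s) * P.real (Y ⁻¹' t) := by
  simp only [Measure.real, h.measure_inter_preimage_eq_mul s t hs ht, ENNReal.toReal_mul]

theorem one_sub_le_measureReal_le_or_le {Ω : Type*} [MeasurableSpace Ω] {P : Measure Ω}
    [IsProbabilityMeasure P] {X Y : Ω → ℝ} (hX : Measurable X) (hY : Measurable Y)
    (hindep : IndepFun X Y P) {r a : ℝ} (hXa : P.real {x | X x < r} ^ 2 ≤ a)
    (hYa : P.real {x | Y x < r} ^ 2 ≤ a) :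
    1 - a ≤ P.real {x | r ≤ X x ∨ r ≤ Y x} := by
  have hc : {x | r ≤ X x ∨ r ≤ Y x} = (X ⁻¹' Set.Iio r ∩ Y ⁻¹' Set.Iio r)ᶜ := by
    ext x; simp [imp_iff_not_or]
  rw [hc, probReal_compl_eq_one_sub ((hX measurableSet_Iio).inter (hY measurableSet_Iio)),
    measureReal_inter_preimage_eq_mul_of_indepFun hindep measurableSet_Iio
      measurableSet_Iio]
  have hX' : P.real (X ⁻¹' Set.Iio r) ^ 2 ≤ a := hXa
  have hY' : P.real (Y ⁻¹' Set.Iio r) ^ 2 ≤ a := hYa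
  nlinarith [sq_nonneg (P.real (X ⁻¹' Set.Iio r) - P.real (Y ⁻¹' Set.Iio r))]

section Probes

variable {Ω : Type*} [MeasurableSpace Ω] {P : Measure Ω} [IsProbabilityMeasure P] {p : ℕ}
  {κ : Type*} {θ : Fin p → κ → Ω → ℝ}

theorem measureReal_norm_phaseSum_sub_lt_sq_le (hp : 1 ≤ p) (hθ : ∀ k j, Measurable (θ k j))
    (hlaw : ∀ k j, pdf.IsUniform (θ k j) (Set.Icc 0 (2 * Real.pi)) P volume)
    (hindep : iIndepFun (fun q : Fin p × κ => θ q.1 q.2) P) {i j : κ} (hij : i ≠ j)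
    {t : ℝ} (ht : 0 ≤ t) :
    P.real {x | ‖phaseSum fun k => θ k i x - θ k j x‖ < Real.sqrt 2 * t * Real.sqrt p} ^ 2 ≤
      2 * t * Real.sqrt (2 / Real.pi) + 4 / Real.sqrt p := by
  have hpair : ∀ k, IndepFun (θ k i) (θ k j) P := fun k =>
    hindep.indepFun (i := (k, i)) (j := (k, j)) fun h => hij (Prod.ext_iff.1 h).2
  have hrows : iIndepFun (fun k x (b : Bool) => θ k (bif b then i else j) x) P := by
    refine iIndepFun_curry (κ := fun _ => Bool) (fun k b => hθ k _) ?_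
    refine hindep.precomp (g := fun q : (_ : Fin p) × Bool => (q.1, bif q.2 then i else j)) ?_
    rintro ⟨k, b⟩ ⟨k', b'⟩ h
    obtain ⟨h1, h2⟩ := Prod.ext_iff.1 h
    dsimp only at h1 h2
    subst h1
    cases b <;> cases b' <;> simp_all [eq_comm]
  have hX := hrows.comp
    (fun _ (v : Bool → ℝ) => Complex.exp (Complex.I * ((v true - v false : ℝ) : ℂ)))
    (fun _ => by fun_prop)
  refine measureReal_norm_sum_lt_sq_le hp (fun k => ?_) (fun k x => ?_) (fun k => ?_) (fun k => ?_)
    hX ht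
  · have := hθ k i
    have := hθ k j
    simp only [Function.comp_def, cond_true, cond_false]
    fun_prop
  · exact Complex.norm_exp_I_mul_ofReal _
  · simpa using integral_cexp_sub_eq_zero (hθ k i) (hθ k j) (hlaw k i) (hpair k) one_ne_zero
  · exact_mod_cast integral_cexp_sub_eq_zero (hθ k i) (hθ k j) (hlaw k i) (hpair k) two_ne_zero

/-- Pairs of columns of the lattice with the same displacement share their sensor sum, but disjoint
pairs have independent probe sums. -/
theorem one_sub_le_measureReal_probe [Fintype κ] (hp : 1 ≤ p) (hθ : ∀ k j, Measurable (θ k j))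
    (hlaw : ∀ k j, pdf.IsUniform (θ k j) (Set.Icc 0 (2 * Real.pi)) P volume)
    (hindep : iIndepFun (fun q : Fin p × κ => θ q.1 q.2) P) {i j i' j' : κ} (hij : i ≠ j)
    (hij' : i' ≠ j') (h1 : i ≠ i') (h2 : i ≠ j') (h3 : j ≠ i') (h4 : j ≠ j')
    {t : ℝ} (ht : 0 ≤ t) :
    1 - (2 * t * Real.sqrt (2 / Real.pi) + 4 / Real.sqrt p) ≤
      P.real {x | Real.sqrt 2 * t * Real.sqrt p ≤ ‖phaseSum fun k => θ k i x - θ k j x‖ ∨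
        Real.sqrt 2 * t * Real.sqrt p ≤ ‖phaseSum fun k => θ k i' x - θ k j' x‖} := by
  have hm : Continuous fun v : Fin p × Bool → ℝ =>
      ‖phaseSum fun k => v (k, true) - v (k, false)‖ :=
    (continuous_phaseSum.comp (by fun_prop)).norm
  have hblocks := indepFun_pi_of_forall_ne (fun q : Fin p × κ => hθ q.1 q.2) hindep
    (a := fun q : Fin p × Bool => (q.1, bif q.2 then i else j))
    (b := fun q : Fin p × Bool => (q.1, bif q.2 then i' else j')) (by
      rintro ⟨k, b⟩ ⟨k', b'⟩ h
      have h5 := (Prod.ext_iff.1 h).2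
      cases b <;> cases b' <;> simp_all)
  have hmeas : ∀ i j, Measurable fun x => ‖phaseSum fun k => θ k i x - θ k j x‖ := fun i j =>
    (continuous_phaseSum.measurable.comp
      (measurable_pi_lambda _ fun k => (hθ k i).sub (hθ k j))).norm
  exact one_sub_le_measureReal_le_or_le (hmeas i j) (hmeas i' j')
    (hblocks.comp hm.measurable hm.measurable)
    (measureReal_norm_phaseSum_sub_lt_sq_le hp hθ hlaw hindep hij ht)
    (measureReal_norm_phaseSum_sub_lt_sq_le hp hθ hlaw hindep hij' ht)

end Probes

section Sensors

variable {Ω : Type*} [MeasurableSpace Ω] {P : Measure Ω} [IsProbabilityMeasure P] {M n : ℕ}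
  {A t : ℝ} {ξ : Fin n → Ω → ℝ}

theorem measureReal_norm_phaseSum_sensor_lt_sq_le (hM : 2 < M) (hn : 1 ≤ n) (hA : A ≠ 0)
    (hξ : ∀ l, Measurable (ξ l)) (hlaw : ∀ l, P.map (ξ l) = uniformOn (sensorCoords M A))
    (hindep : iIndepFun ξ P) (ht : 0 ≤ t) :
    P.real {x | ‖phaseSum fun l => 2 * Real.pi / A * ξ l x‖ < Real.sqrt 2 * t * Real.sqrt n} ^ 2 ≤
      2 * t * Real.sqrt (2 / Real.pi) + 4 / Real.sqrt n := by
  have hX := hindep.comp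
    (fun _ (y : ℝ) => Complex.exp (Complex.I * ((2 * Real.pi / A * y : ℝ) : ℂ)))
    (fun _ => by fun_prop)
  refine measureReal_norm_sum_lt_sq_le hn (fun l => ?_) (fun l x => ?_) (fun l => ?_) (fun l => ?_)
    hX ht
  · have := hξ l
    simp only [Function.comp_def]
    fun_prop
  · exact Complex.norm_exp_I_mul_ofReal _
  · simpa using integral_cexp_sensor_eq_zero hA (hξ l) (hlaw l) one_pos (by omega : 1 < M)
  · exact integral_cexp_sensor_eq_zero hA (hξ l) (hlaw l) two_pos hM

theorem measureReal_norm_phaseSum_sensor_two_lt_le (hn : 1 ≤ n) (hA : A ≠ 0)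
    (hξ : ∀ l, Measurable (ξ l)) (hlaw : ∀ l, P.map (ξ l) = uniformOn (sensorCoords 2 A))
    (hindep : iIndepFun ξ P) (ht : 0 ≤ t) :
    P.real {x | ‖phaseSum fun l => 2 * Real.pi / A * ξ l x‖ < Real.sqrt 2 * t * Real.sqrt n} ≤
      2 * t * Real.sqrt (2 / Real.pi) + 4 / Real.sqrt n := by
  have hn0 : (0 : ℝ) < n := by exact_mod_cast hn
  have hsn : 0 < Real.sqrt n := Real.sqrt_pos.2 hn0
  have hε := hindep.comp (fun _ (y : ℝ) => Real.cos (2 * Real.pi / A * y)) (fun _ => by fun_prop)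
  have h := measureReal_abs_sum_lt_le (R := Real.sqrt 2 * t * Real.sqrt n)
    (fun l => by have := hξ l; simp only [Function.comp_def]; fun_prop) hε
    (fun l => measureReal_cos_sensor_two hA (hξ l) (hlaw l) (Or.inl rfl))
    (fun l => measureReal_cos_sensor_two hA (hξ l) (hlaw l) (Or.inr rfl)) (by positivity)
  have hre : ∀ x, |∑ l, Real.cos (2 * Real.pi / A * ξ l x)| ≤
      ‖phaseSum fun l => 2 * Real.pi / A * ξ l x‖ := fun x => by
    have hre' : (phaseSum fun l => 2 * Real.pi / A * ξ l x).re =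
        ∑ l, Real.cos (2 * Real.pi / A * ξ l x) := by
      simp only [phaseSum, Complex.re_sum]
      exact Finset.sum_congr rfl fun l _ => by rw [mul_comm, Complex.exp_ofReal_mul_I_re]
    rw [← hre']
    exact Complex.abs_re_le_norm _
  refine (measureReal_mono fun x hx => ?_).trans (h.trans ?_)
  · exact (hre x).trans_lt hx
  · have hπ : Real.sqrt Real.pi ≤ 2 :=
      Real.sqrt_le_iff.2 ⟨by norm_num, by linarith [Real.pi_le_four]⟩
    have h2 : Real.sqrt 2 * t ≤ 2 * t * Real.sqrt (2 / Real.pi) := by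
      rw [Real.sqrt_div zero_le_two, mul_div_assoc', le_div_iff₀ (Real.sqrt_pos.2 Real.pi_pos)]
      have : 0 ≤ Real.sqrt 2 * t := by positivity
      nlinarith
    calc (Real.sqrt 2 * t * Real.sqrt n + 1) / Real.sqrt (n + 1)
        ≤ (Real.sqrt 2 * t * Real.sqrt n + 1) / Real.sqrt n := by gcongr; linarith
      _ = Real.sqrt 2 * t + 1 / Real.sqrt n := by field_simp
      _ ≤ _ := by gcongr; norm_num

/-- The sensor sums of the displacements along the two axes are independent. With two positions per
axis the steps are real, and a single axis suffices. -/
theorem one_sub_le_measureReal_sensor (hM : 2 ≤ M) (hn : 1 ≤ n) (hA : A ≠ 0) {η : Fin n → Ω → ℝ}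
    (hξ : ∀ l, Measurable (ξ l)) (hη : ∀ l, Measurable (η l))
    (hξlaw : ∀ l, P.map (ξ l) = uniformOn (sensorCoords M A))
    (hηlaw : ∀ l, P.map (η l) = uniformOn (sensorCoords M A))
    (hindep : iIndepFun (Sum.elim ξ η) P) (ht : 0 ≤ t) :
    1 - (2 * t * Real.sqrt (2 / Real.pi) + 4 / Real.sqrt n) ≤
      P.real {x | Real.sqrt 2 * t * Real.sqrt n ≤ ‖phaseSum fun l => 2 * Real.pi / A * ξ l x‖ ∨
        Real.sqrt 2 * t * Real.sqrt n ≤ ‖phaseSum fun l => 2 * Real.pi / A * η l x‖} := by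
  have hcont : Continuous fun v : Fin n → ℝ => ‖phaseSum fun l => 2 * Real.pi / A * v l‖ :=
    (continuous_phaseSum.comp (by fun_prop)).norm
  have hξm : Measurable fun x => ‖phaseSum fun l => 2 * Real.pi / A * ξ l x‖ :=
    hcont.measurable.comp (measurable_pi_lambda _ hξ)
  have hηm : Measurable fun x => ‖phaseSum fun l => 2 * Real.pi / A * η l x‖ :=
    hcont.measurable.comp (measurable_pi_lambda _ hη)
  have hξi : iIndepFun ξ P := hindep.precomp (g := Sum.inl) Sum.inl_injective
  have hηi : iIndepFun η P := hindep.precomp (g := Sum.inr) Sum.inr_injective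
  rcases hM.eq_or_lt with rfl | hM3
  · have h := measureReal_norm_phaseSum_sensor_two_lt_le hn hA hξ hξlaw hξi ht
    have hc := probReal_compl_eq_one_sub (μ := P)
      (measurableSet_lt hξm (measurable_const (a := Real.sqrt 2 * t * Real.sqrt n)))
    refine le_trans (by linarith) (measureReal_mono (μ := P) (s₁ :=
      {x | ‖phaseSum fun l => 2 * Real.pi / A * ξ l x‖ < Real.sqrt 2 * t * Real.sqrt n}ᶜ)
      fun x hx => Or.inl (not_lt.1 hx))
  · have hblocks := indepFun_pi_of_forall_ne (f := Sum.elim ξ η)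
      (by rintro (l | l); exacts [hξ l, hη l]) hindep (a := Sum.inl) (b := Sum.inr)
      (fun _ _ => Sum.inl_ne_inr)
    exact one_sub_le_measureReal_le_or_le hξm hηm
      (hblocks.comp hcont.measurable hcont.measurable)
      (measureReal_norm_phaseSum_sensor_lt_sq_le hM3 hn hA hξ hξlaw hξi ht)
      (measureReal_norm_phaseSum_sensor_lt_sq_le hM3 hn hA hη hηlaw hηi ht)

end Sensors

/-! ### Lower bound for the coherence -/

/-- Under the Rayleigh condition the sensor phases of two neighbouring lattice points differ, up to
a constant, by `2π ξ / A`. -/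
theorem wavenumber_mul_sq_sub_sq {A ell lam z₀ : ℝ} (hA : 0 < A) (hlam : 0 < lam) (hz₀ : 0 < z₀)
    (rayleigh : A * ell / (lam * z₀) = 1) (u : ℝ) :
    wavenumber lam / (2 * z₀) * (((0 + 1) * ell - u) ^ 2 - ((1 + 1) * ell - u) ^ 2) =
      -3 * ell ^ 2 * (wavenumber lam / (2 * z₀)) + 2 * Real.pi / A * u := by
  have h : A * ell = lam * z₀ := by
    rwa [div_eq_one_iff_eq (by positivity)] at rayleigh
  have h2 : 2 * Real.pi / A = wavenumber lam / (2 * z₀) * (2 * ell) := by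
    rw [wavenumber]
    field_simp
    linear_combination -h
  rw [h2]; ring

/-- For lattice neighbours `i` and `j` the inner product of the two columns factors into a probe sum
and the sensor sum of the coordinate in which `i` and `j` differ. -/
theorem le_worstCaseCoherence_of_le {M n p : ℕ} (hn : 1 ≤ n) (hp : 1 ≤ p) {A ell lam z₀ : ℝ}
    (hA : 0 < A) (hlam : 0 < lam) (hz₀ : 0 < z₀) (rayleigh : A * ell / (lam * z₀) = 1)
    (θ : Fin p → Fin M × Fin M → ℝ) (ξ η : Fin n → ℝ) {t₁ t₂ : ℝ} (ht₂ : 0 ≤ t₂)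
    {i j : Fin M × Fin M} (hij : i ≠ j) {ζ : Fin n → ℝ}
    (hζ : (ζ = ξ ∧ (i.1 : ℕ) = 0 ∧ (j.1 : ℕ) = 1 ∧ i.2 = j.2) ∨
      (ζ = η ∧ (i.2 : ℕ) = 0 ∧ (j.2 : ℕ) = 1 ∧ i.1 = j.1))
    (hS : Real.sqrt 2 * t₁ * Real.sqrt p ≤ ‖phaseSum fun k => θ k i - θ k j‖)
    (hT : Real.sqrt 2 * t₂ * Real.sqrt n ≤ ‖phaseSum fun l => 2 * Real.pi / A * ζ l‖) :
    2 * t₁ * t₂ / Real.sqrt ((n : ℝ) * p) ≤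
      worstCaseCoherence (sensingMatrix lam z₀ ell θ ξ η) := by
  have hn0 : (0 : ℝ) < n := by exact_mod_cast hn
  have hp0 : (0 : ℝ) < p := by exact_mod_cast hp
  refine le_trans ?_ (le_worstCaseCoherence_sensingMatrix hn hp lam z₀ ell θ ξ η hij)
  have hphase : ∀ l, wavenumber lam / (2 * z₀) *
      ((latticeCoord ell i.1 - ξ l) ^ 2 - (latticeCoord ell j.1 - ξ l) ^ 2 +
        ((latticeCoord ell i.2 - η l) ^ 2 - (latticeCoord ell j.2 - η l) ^ 2)) =
      -3 * ell ^ 2 * (wavenumber lam / (2 * z₀)) + 2 * Real.pi / A * ζ l := fun l => by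
    rcases hζ with ⟨rfl, h0, h1, h2⟩ | ⟨rfl, h0, h1, h2⟩ <;>
      rw [← wavenumber_mul_sq_sub_sq hA hlam hz₀ rayleigh] <;>
      simp only [latticeCoord, h0, h1, h2] <;> push_cast <;> ring
  simp_rw [hphase]
  change _ ≤ ‖phaseSum fun k => θ k i - θ k j‖ * ‖phaseSum fun l =>
    -3 * ell ^ 2 * (wavenumber lam / (2 * z₀)) + 2 * Real.pi / A * ζ l‖ / (n * p)
  rw [norm_phaseSum_const_add]
  have hprod : 2 * t₁ * t₂ / Real.sqrt ((n : ℝ) * p) =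
      (Real.sqrt 2 * t₁ * Real.sqrt p) * (Real.sqrt 2 * t₂ * Real.sqrt n) / (n * p) := by
    have h2 : Real.sqrt 2 * Real.sqrt 2 = 2 := Real.mul_self_sqrt zero_le_two
    have h3 : Real.sqrt n * Real.sqrt n = n := Real.mul_self_sqrt hn0.le
    have h4 : Real.sqrt p * Real.sqrt p = p := Real.mul_self_sqrt hp0.le
    have h5 : 0 < Real.sqrt n := Real.sqrt_pos.2 hn0
    have h6 : 0 < Real.sqrt p := Real.sqrt_pos.2 hp0
    rw [Real.sqrt_mul hn0.le, div_eq_div_iff (by positivity) (by positivity)]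
    linear_combination (-(t₁ * t₂ * n * p)) * h2 - Real.sqrt 2 ^ 2 * t₁ * t₂ * p * h3 -
      Real.sqrt 2 ^ 2 * t₁ * t₂ * Real.sqrt n ^ 2 * h4
  rw [hprod]
  gcongr

theorem lemma2
    {Ω : Type*} [MeasurableSpace Ω] (P : Measure Ω) [IsProbabilityMeasure P]
    (M n p : ℕ) (hM : 2 ≤ M) (hn : 1 ≤ n) (hp : 1 ≤ p)
    (A ell lam z₀ : ℝ) (hA : 0 < A) (hell : 0 < ell) (hlam : 0 < lam) (hz₀ : 0 < z₀)
    (rayleigh : A * ell / (lam * z₀) = 1)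
    (θ : Fin p → Fin M × Fin M → Ω → ℝ) (ξ η : Fin n → Ω → ℝ)
    (hθ_meas : ∀ k j, Measurable (θ k j))
    (hξ_meas : ∀ l, Measurable (ξ l)) (hη_meas : ∀ l, Measurable (η l))
    (hθ_law : ∀ k j, pdf.IsUniform (θ k j) (Set.Icc 0 (2 * Real.pi)) P volume)
    (hξ_law : ∀ l, P.map (ξ l) = uniformOn (sensorCoords M A))
    (hη_law : ∀ l, P.map (η l) = uniformOn (sensorCoords M A))
    (hindep : iIndepFun
      (Sum.elim (fun a : Fin p × (Fin M × Fin M) => θ a.1 a.2) (Sum.elim ξ η)) P)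
    (t₁ t₂ : ℝ) (ht₁ : 0 ≤ t₁) (ht₂ : 0 ≤ t₂)
    (hfactor : 0 ≤ 1 - 2 * t₁ * Real.sqrt (2 / Real.pi) - 4 / Real.sqrt p ∨
      0 ≤ 1 - 2 * t₂ * Real.sqrt (2 / Real.pi) - 4 / Real.sqrt n) :
    P.real {x | worstCaseCoherence
          (sensingMatrix lam z₀ ell (fun k j => θ k j x) (fun l => ξ l x) (fun l => η l x))
        ≥ 2 * t₁ * t₂ / Real.sqrt ((n : ℝ) * p)} ≥
      (1 - 2 * t₁ * Real.sqrt (2 / Real.pi) - 4 / Real.sqrt p) *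
        (1 - 2 * t₂ * Real.sqrt (2 / Real.pi) - 4 / Real.sqrt n) := by
  set u := 1 - 2 * t₁ * Real.sqrt (2 / Real.pi) - 4 / Real.sqrt p with hu
  set v := 1 - 2 * t₂ * Real.sqrt (2 / Real.pi) - 4 / Real.sqrt n with hv
  -- If the probe factor is negative, the other one is not, and the product is at most zero.
  rcases lt_or_ge u 0 with hu0 | hu0
  · have hv0 : 0 ≤ v := hfactor.resolve_left (not_le.2 hu0)
    exact (mul_nonpos_of_nonpos_of_nonneg hu0.le hv0).trans measureReal_nonneg
  have hmeas : ∀ s, Measurable (Sum.elim (fun a : Fin p × (Fin M × Fin M) => θ a.1 a.2)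
      (Sum.elim ξ η) s) := by
    rintro (a | l | l)
    exacts [hθ_meas a.1 a.2, hξ_meas l, hη_meas l]
  have hθi : iIndepFun (fun q : Fin p × (Fin M × Fin M) => θ q.1 q.2) P :=
    hindep.precomp (g := Sum.inl) Sum.inl_injective
  have hξηi : iIndepFun (Sum.elim ξ η) P := hindep.precomp (g := Sum.inr) Sum.inr_injective
  have hblocks := indepFun_pi_of_forall_ne hmeas hindep (a := Sum.inl) (b := Sum.inr)
    (fun _ _ => Sum.inl_ne_inr)
  set Θ : Ω → Fin p × (Fin M × Fin M) → ℝ := fun x q => θ q.1 q.2 x with hΘ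
  set Z : Ω → Fin n ⊕ Fin n → ℝ := fun x s => Sum.elim ξ η s x with hZ
  have hΘm : Measurable Θ := measurable_pi_lambda _ fun q => hθ_meas q.1 q.2
  have hZm : Measurable Z := measurable_pi_lambda _ fun s => hmeas (Sum.inr s)
  have hΘZ : IndepFun Θ Z P := hblocks
  have hmul : ∀ {s t}, MeasurableSet s → MeasurableSet t →
      P.real (Θ ⁻¹' s ∩ Z ⁻¹' t) = P.real (Θ ⁻¹' s) * P.real (Z ⁻¹' t) :=
    measureReal_inter_preimage_eq_mul_of_indepFun hΘZ
  -- The four corners of a unit square: two disjoint horizontal edges and two disjoint vertical ones.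
  let o : Fin M := ⟨0, by omega⟩
  let e : Fin M := ⟨1, by omega⟩
  have hoe : o ≠ e := by simp [o, e]
  let probe (i j i' j' : Fin M × Fin M) : Set (Fin p × (Fin M × Fin M) → ℝ) :=
    {w | Real.sqrt 2 * t₁ * Real.sqrt p ≤ ‖phaseSum fun k => w (k, i) - w (k, j)‖ ∨
      Real.sqrt 2 * t₁ * Real.sqrt p ≤ ‖phaseSum fun k => w (k, i') - w (k, j')‖}
  let sensor (c : Fin n → Fin n ⊕ Fin n) : Set (Fin n ⊕ Fin n → ℝ) :=
    {w | Real.sqrt 2 * t₂ * Real.sqrt n ≤ ‖phaseSum fun l => 2 * Real.pi / A * w (c l)‖}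
  have hprobe : ∀ i j i' j', MeasurableSet (probe i j i' j') := fun i j i' j' =>
    ((isClosed_le continuous_const (continuous_phaseSum.comp (by fun_prop)).norm).union
      (isClosed_le continuous_const (continuous_phaseSum.comp (by fun_prop)).norm)).measurableSet
  have hsensor : ∀ c, MeasurableSet (sensor c) := fun c =>
    (isClosed_le continuous_const (continuous_phaseSum.comp (by fun_prop)).norm).measurableSet
  have hx : u ≤ P.real (Θ ⁻¹' probe (o, o) (e, o) (o, e) (e, e)) := by
    have h := one_sub_le_measureReal_probe hp hθ_meas hθ_law hθi
      (i := (o, o)) (j := (e, o)) (i' := (o, e)) (j' := (e, e)) (by simp [hoe]) (by simp [hoe])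
      (by simp [hoe]) (by simp [hoe]) (by simp [hoe.symm]) (by simp [hoe]) ht₁
    exact le_trans (by linarith) h
  have hy : u ≤ P.real (Θ ⁻¹' probe (o, o) (o, e) (e, o) (e, e)) := by
    have h := one_sub_le_measureReal_probe hp hθ_meas hθ_law hθi
      (i := (o, o)) (j := (o, e)) (i' := (e, o)) (j' := (e, e)) (by simp [hoe]) (by simp [hoe])
      (by simp [hoe]) (by simp [hoe]) (by simp [hoe]) (by simp [hoe]) ht₁
    exact le_trans (by linarith) h
  have hs : v ≤ P.real (Z ⁻¹' sensor Sum.inl ∪ Z ⁻¹' sensor Sum.inr) := by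
    have h := one_sub_le_measureReal_sensor hM hn hA.ne' hξ_meas hη_meas hξ_law hη_law hξηi ht₂
    exact le_trans (by linarith) h
  have hfin := mul_le_measureReal_inter_union_inter (hΘm (hprobe _ _ _ _)) (hZm (hsensor _))
    (hZm (hsensor _)) (hmul (hprobe (o, o) (e, o) (o, e) (e, e)) (hsensor Sum.inl))
    (hmul (hprobe (o, o) (o, e) (e, o) (e, e)) ((hsensor Sum.inr).diff (hsensor Sum.inl)))
    hu0 hx hy hs
  refine hfin.trans (measureReal_mono ?_)
  have key := fun x ζ i j hij => le_worstCaseCoherence_of_le hn hp hA hlam hz₀ rayleigh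
    (fun k j => θ k j x) (fun l => ξ l x) (fun l => η l x) ht₂
    (t₁ := t₁) (i := i) (j := j) (ζ := ζ) hij
  rintro x (⟨h1 | h1, h2⟩ | ⟨h1 | h1, h2⟩)
  · exact key x (ξ · x) (o, o) (e, o) (by simp [hoe]) (Or.inl ⟨rfl, rfl, rfl, rfl⟩) h1 h2
  · exact key x (ξ · x) (o, e) (e, e) (by simp [hoe]) (Or.inl ⟨rfl, rfl, rfl, rfl⟩) h1 h2
  · exact key x (η · x) (o, o) (o, e) (by simp [hoe]) (Or.inr ⟨rfl, rfl, rfl, rfl⟩) h1 h2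
  · exact key x (η · x) (e, o) (e, e) (by simp [hoe]) (Or.inr ⟨rfl, rfl, rfl, rfl⟩) h1 h2
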